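/- Let $G$ be a finite abelian group of order $2^n$ ($n\ge 0$) and let $k\ge 2$. For a random variable $X$ with values in $G$ write $H(X)=-\sum_{g\in G}P(X=g)\log P(X=g)$ for its Shannon entropy (natural logarithm, $0\log 0=0$). For $(x_1,\dots,x_k)\in[0,\log|G|]^k$ define $$f_{G,k}(x_1,\dots,x_k)=\min H(X_1+X_2+\dots+X_k),$$ where the minimum is over all families of independent $G$-valued random variables $X_1,\dots,X_k$ with $H(X_i)=x_i$ for $1\le i\le k$. Then this minimum exists for every $(x_1,\dots,x_k)\in[0,\log|G|]^k$, and $f_{G,k}$ is convex in each variable when the others are fixed: for every $i\in\{1,\dots,k\}$ and all fixed $x_j\in[0,\log|G|]$, $j\ne i$, the function $$x_i\longmapsto f_{G,k}(x_1,\dots,x_k)$$ is convex on $[0,\log|G|]$. -/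

import Mathlib

universe u v

open MeasureTheory ProbabilityTheory

/-- Shannon entropy (natural logarithm) of a random variable `X` taking values in a finite set:
`H(X) = ∑ g, - P(X = g) log P(X = g)`, with the convention `0 log 0 = 0`. -/
noncomputable def shannonEntropy {Ω : Type v} [MeasurableSpace Ω] {G : Type u} [Fintype G]
    (P : Measure Ω) (X : Ω → G) : ℝ :=
  ∑ g : G, Real.negMulLog (P.real (X ⁻¹' {g}))

/-- The set of all values `H(X₁ + ⋯ + X_k)`, where `X₁, …, X_k` are independent `G`-valued random
variables, on any probability space, with `H(X_i) = x_i` for every `i`. The entropies depend on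
the joint law on `G ^ k` only, so nothing is lost by taking the probability space in the universe
of `G`. -/
def sumEntropies (G : Type u) [AddCommGroup G] [Fintype G] [MeasurableSpace G] (k : ℕ)
    (x : Fin k → ℝ) : Set ℝ :=
  {h | ∃ (Ω : Type u) (_ : MeasurableSpace Ω) (P : Measure Ω) (X : Fin k → Ω → G),
    IsProbabilityMeasure P ∧ (∀ i, Measurable (X i)) ∧ iIndepFun X P ∧
      (∀ i, shannonEntropy P (X i) = x i) ∧ shannonEntropy P (fun ω => ∑ i, X i ω) = h}

/-- `f_{G,k}(x₁, …, x_k)`, the minimum of `H(X₁ + ⋯ + X_k)` over independent `G`-valued random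
variables with `H(X_i) = x_i`. It is meaningful when every `x_i` lies in `[0, log |G|]`; that the
infimum is then attained, that is, a minimum, is part of the theorem. -/
noncomputable def minSumEntropy (G : Type u) [AddCommGroup G] [Fintype G] [MeasurableSpace G]
    (k : ℕ) (x : Fin k → ℝ) : ℝ :=
  sInf (sumEntropies G k x)

/-!
The idea is that a sum in a group of order `2 ^ n` behaves like `n` independent sums of bits.

**Two bits.** A bit with bias `a` has entropy `biasEntropy a`, and the sum of independent bits has
the product of their biases as its bias, so the minimal (indeed the only) entropy of the sum is
`bitSum x y = φ (ψ x * ψ y)`, with `φ = biasEntropy` and `ψ = bias` its inverse. With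
`W a = a artanh a` the gradient of `bitSum` at `x = φ a`, `y = φ b` is
`(W (a b) / W a, W (a b) / W b)`. The function `K s = (1 - s ^ 2) artanh s / s` controls its
variation: `K` decreases, which makes `bitSum` convex in each variable (`convexOn_bitSum`, Mrs.
Gerber's lemma), and `K (a b) ≤ K a + K b`, which makes its Hessian indefinite and its gradient
injective (`eq_of_wFun_crit`).

**Several bits.** By the last two facts, `bitSum u₁ v₁ + bitSum u₂ v₂`, with `u₁ + u₂` and
`v₁ + v₂` fixed, has no minimum in the interior, and the boundary is easy to inspect: the minimum
is attained when one bit is filled as far as possible before the other one is used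
(`bitSumSplit_le`). Iteration gives the function `levelSum n` and the inequality
`levelSum_add_le`. From Mrs. Gerber's lemma, `levelSum n` is convex in each variable
(`convexOn_levelSum`).

**Lower bound.** Divide by a subgroup `{0, τ}` of order two. The chain rule for the entropy
(`ent_eq_push_add`), superadditivity of `pairEnt` and Jensen's inequality for `bitSum`
(`bitSum_fibreEnt_le`), together with induction on `n`, bound the entropy of a sum of two
independent variables below by `levelSum n` (`levelSum_le_ent_conv`).

**Attainment.** For a chain of subgroups of orders `1, 2, 4, …, 2 ^ n`, the distributions that are
uniform on the cosets of one subgroup and live on the next one form a family `D t`, indexed by the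
entropy `t ∈ [0, n log 2]`, with `D s ∗ D t = D (levelSum n s t)` (`exists_isExtremalFamily`). As
this family is closed under convolution and attains the lower bound, it is optimal for any number
of summands, and as a function of one entropy the minimum is `t ↦ levelSum n t c`, where `c` is
the minimal entropy of the sum of the other variables (`exists_isLeast_sumEntropies`).
-/

namespace EntropySum

open Set Filter Topology

/-! ### Inverse functions and a second order test -/

/-- A continuous strictly increasing function on `[p, q]` has a continuous inverse on
`[f p, f q]`. -/
theorem exists_continuousOn_inverse {f : ℝ → ℝ} {p q : ℝ} (hpq : p ≤ q)
    (hf : StrictMonoOn f (Icc p q)) (hc : ContinuousOn f (Icc p q)) :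
    ∃ g : ℝ → ℝ, ContinuousOn g (Icc (f p) (f q)) ∧ MapsTo g (Icc (f p) (f q)) (Icc p q) ∧
      ∀ y ∈ Icc (f p) (f q), f (g y) = y := by
  have hsurj : ∀ y ∈ Icc (f p) (f q), ∃ x ∈ Icc p q, f x = y := intermediate_value_Icc hpq hc
  choose! g hg hfg using hsurj
  refine ⟨g, ?_, hg, hfg⟩
  rw [continuousOn_iff_continuous_domRestrict]
  let g' : Icc (f p) (f q) → Icc p q := fun y => ⟨g y, hg y y.2⟩
  have hmono : Monotone g' := by
    intro y z hyz
    change g y ≤ g z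
    rw [← hf.le_iff_le (hg y y.2) (hg z z.2), hfg y y.2, hfg z z.2]
    exact hyz
  have hs : Function.Surjective g' := by
    intro x
    have hfx : f x ∈ Icc (f p) (f q) :=
      ⟨hf.monotoneOn (left_mem_Icc.2 hpq) x.2 x.2.1, hf.monotoneOn x.2 (right_mem_Icc.2 hpq) x.2.2⟩
    refine ⟨⟨f x, hfx⟩, Subtype.ext ?_⟩
    exact hf.injOn (hg _ hfx) x.2 (hfg _ hfx)
  exact continuous_subtype_val.comp (hmono.continuous_of_surjective hs)

/-- If `γ'' (0) < 0`, then `0` is not a local minimum of the symmetrization `γ t + γ (-t)`. -/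
theorem not_eventually_two_mul_le {γ g : ℝ → ℝ} {c : ℝ}
    (hγ : ∀ᶠ t in 𝓝 0, HasDerivAt γ (g t) t) (hg : HasDerivAt g c 0) (hc : c < 0) :
    ¬ ∀ᶠ t in 𝓝 0, 2 * γ 0 ≤ γ t + γ (-t) := by
  intro hmin
  have hneg : Tendsto (fun t : ℝ => -t) (𝓝 0) (𝓝 0) := by
    simpa using (continuous_neg (G := ℝ)).tendsto 0
  -- the strictness of the second order condition leaves room for the quadratic term
  set F : ℝ → ℝ := fun t => γ t + γ (-t) + (-c / 2) * t ^ 2 with hF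
  have hdF : ∀ᶠ t in 𝓝 0, HasDerivAt F (g t - g (-t) + (-c) * t) t := by
    filter_upwards [hγ, hneg.eventually hγ] with t h1 h2
    have h3 : HasDerivAt (fun t => γ (-t)) (g (-t) * -1) t := h2.comp t (hasDerivAt_neg t)
    have h4 := (h1.add h3).add (((hasDerivAt_id t).pow 2).const_mul (-c / 2))
    refine h4.congr_deriv ?_
    simp only [id]; push_cast; ring
  have hd : deriv F =ᶠ[𝓝 0] fun t => g t - g (-t) + (-c) * t :=
    hdF.mono fun t h => h.deriv
  have hg' : HasDerivAt (fun t => g (-t)) (c * -1) 0 := by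
    have : HasDerivAt g c (-0) := by simpa using hg
    exact this.comp 0 (hasDerivAt_neg 0)
  have hdd : deriv (deriv F) 0 = c := by
    rw [hd.deriv_eq]
    have := (hg.sub hg').add ((hasDerivAt_id (0 : ℝ)).const_mul (-c))
    refine (this.congr_deriv ?_).deriv
    ring
  have hmax : IsLocalMax F 0 := by
    refine isLocalMax_of_deriv_deriv_neg (by rw [hdd]; exact hc) ?_ hdF.self_of_nhds.continuousAt
    rw [hd.self_of_nhds]; simp
  have hev : ∀ᶠ t in 𝓝 (0 : ℝ), t = 0 := by
    filter_upwards [hmin, hmax] with t h1 h2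
    simp only [hF, neg_zero] at h2
    have : t ^ 2 ≤ 0 := by nlinarith
    exact pow_eq_zero_iff (two_ne_zero) |>.1 (le_antisymm this (sq_nonneg t))
  have hev' : ∀ᶠ t in 𝓝[≠] (0 : ℝ), t = 0 := hev.filter_mono nhdsWithin_le_nhds
  obtain ⟨t, h1, h2⟩ := (hev'.and self_mem_nhdsWithin).exists
  exact h2 h1

/-! ### The inverse hyperbolic tangent -/

/-- `artanh a` for `|a| < 1`, as a difference of logarithms. -/
noncomputable def atanhLog (a : ℝ) : ℝ := (Real.log (1 + a) - Real.log (1 - a)) / 2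

theorem hasDerivAt_atanhLog {a : ℝ} (h0 : -1 < a) (h1 : a < 1) :
    HasDerivAt atanhLog (1 / (1 - a ^ 2)) a := by
  have ha : (1 + a) ≠ 0 := by linarith
  have hb : (1 - a) ≠ 0 := by linarith
  have hd1 : HasDerivAt (fun a : ℝ => 1 + a) 1 a := (hasDerivAt_id a).const_add 1
  have hd2 : HasDerivAt (fun a : ℝ => 1 - a) (-1) a := (hasDerivAt_id a).const_sub 1
  refine (((hd1.log ha).sub (hd2.log hb)).div_const 2).congr_deriv ?_
  have : 1 - a ^ 2 ≠ 0 := by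
    rw [show 1 - a ^ 2 = (1 + a) * (1 - a) by ring]; exact mul_ne_zero ha hb
  field_simp
  ring

@[simp] theorem atanhLog_zero : atanhLog 0 = 0 := by simp [atanhLog]

theorem le_of_hasDerivAt_le {f g f' g' : ℝ → ℝ} (h0 : f 0 ≤ g 0)
    (hf : ∀ a, 0 ≤ a → a < 1 → HasDerivAt f (f' a) a)
    (hg : ∀ a, 0 ≤ a → a < 1 → HasDerivAt g (g' a) a)
    (h : ∀ a, 0 ≤ a → a < 1 → f' a ≤ g' a) {a : ℝ} (ha : 0 ≤ a) (ha1 : a < 1) : f a ≤ g a := by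
  have hmono : MonotoneOn (fun a => g a - f a) (Ico 0 1) := by
    refine monotoneOn_of_hasDerivWithinAt_nonneg (f' := fun a => g' a - f' a) (convex_Ico 0 1)
      (fun a ha => ((hg a ha.1 ha.2).sub (hf a ha.1 ha.2)).continuousAt.continuousWithinAt) ?_ ?_
    · intro a ha
      rw [interior_Ico] at ha
      exact ((hg a ha.1.le ha.2).sub (hf a ha.1.le ha.2)).hasDerivWithinAt
    · intro a ha
      rw [interior_Ico] at ha
      exact sub_nonneg.2 (h a ha.1.le ha.2)
  have := hmono (left_mem_Ico.2 one_pos) ⟨ha, ha1⟩ ha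
  simp only at this
  linarith

theorem self_le_atanhLog {a : ℝ} (ha : 0 ≤ a) (ha1 : a < 1) : a ≤ atanhLog a := by
  refine le_of_hasDerivAt_le (f := id) (f' := fun _ => 1) (by simp) (fun a _ _ => hasDerivAt_id a)
    (fun a h h' => hasDerivAt_atanhLog (by linarith) h') (fun a h h' => ?_) ha ha1
  rw [le_div_iff₀ (by nlinarith)]
  nlinarith

theorem atanhLog_le {a : ℝ} (ha : 0 ≤ a) (ha1 : a < 1) : atanhLog a ≤ a / (1 - a ^ 2) := by
  refine le_of_hasDerivAt_le (g := fun a => a / (1 - a ^ 2))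
    (g' := fun a => (1 + a ^ 2) / (1 - a ^ 2) ^ 2) (by simp)
    (fun a h h' => hasDerivAt_atanhLog (by linarith) h') (fun a h h' => ?_) (fun a h h' => ?_) ha ha1
  · have hne : 1 - a ^ 2 ≠ 0 := by nlinarith
    have h1 : HasDerivAt (fun a : ℝ => 1 - a ^ 2) (-(2 * a)) a := by
      have := ((hasDerivAt_id a).pow 2).const_sub 1
      refine this.congr_deriv ?_
      simp
    refine ((hasDerivAt_id a).div h1 hne).congr_deriv ?_
    simp only [id]; congr 1; ring
  · have hp : 0 < 1 - a ^ 2 := by nlinarith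
    rw [div_le_div_iff₀ hp (by positivity)]
    nlinarith [mul_nonneg hp.le (sq_nonneg a)]

theorem atanhLog_pos {a : ℝ} (ha : 0 < a) (ha1 : a < 1) : 0 < atanhLog a :=
  ha.trans_le (self_le_atanhLog ha.le ha1)

theorem continuousOn_atanhLog : ContinuousOn atanhLog (Ioo (-1) 1) := fun _ ha =>
  (hasDerivAt_atanhLog ha.1 ha.2).continuousAt.continuousWithinAt

/-! ### The function `K s = (1 - s ^ 2) artanh s / s` -/

/-- `ratioK s = (1 - s ^ 2) artanh s / s`. At `s = 1` the factor `1 - s ^ 2` makes the value `0`,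
which is also the limit. -/
noncomputable def ratioK (s : ℝ) : ℝ := (1 - s ^ 2) * atanhLog s / s

theorem ratioK_pos {s : ℝ} (h0 : 0 < s) (h1 : s < 1) : 0 < ratioK s :=
  div_pos (mul_pos (by nlinarith) (atanhLog_pos h0 h1)) h0

theorem hasDerivAt_ratioK {s : ℝ} (h0 : 0 < s) (h1 : s < 1) :
    HasDerivAt ratioK ((1 - atanhLog s / s - s * atanhLog s) / s) s := by
  have h2 : HasDerivAt (fun a : ℝ => 1 - a ^ 2) (-(2 * s)) s := by
    have := ((hasDerivAt_id s).pow 2).const_sub 1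
    refine this.congr_deriv ?_
    simp
  have hne : 1 - s ^ 2 ≠ 0 := by nlinarith
  refine ((h2.mul (hasDerivAt_atanhLog (by linarith) h1)).div (hasDerivAt_id s)
    h0.ne').congr_deriv ?_
  simp only [id, Pi.mul_apply]
  field_simp
  ring

theorem continuousOn_ratioK : ContinuousOn ratioK (Ioc 0 1) := by
  have h : ∀ s ∈ Ioc (0 : ℝ) 1, ratioK s =
      ((1 - s) * ((1 + s) * Real.log (1 + s)) - (1 + s) * ((1 - s) * Real.log (1 - s))) / 2 / s := by
    intro s _
    simp only [ratioK, atanhLog]; ring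
  refine ContinuousOn.congr ?_ h
  refine ContinuousOn.div (Continuous.continuousOn ?_) continuousOn_id fun s hs => hs.1.ne'
  have h1 : Continuous fun s : ℝ => (1 + s) * Real.log (1 + s) :=
    Real.continuous_mul_log.comp (by fun_prop : Continuous fun s : ℝ => 1 + s)
  have h2 : Continuous fun s : ℝ => (1 - s) * Real.log (1 - s) :=
    Real.continuous_mul_log.comp (by fun_prop : Continuous fun s : ℝ => 1 - s)
  fun_prop

theorem antitoneOn_ratioK : AntitoneOn ratioK (Ioc 0 1) := by
  refine antitoneOn_of_hasDerivWithinAt_nonpos (convex_Ioc 0 1) continuousOn_ratioK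
    (f' := fun s => (1 - atanhLog s / s - s * atanhLog s) / s) ?_ ?_
  · intro s hs
    rw [interior_Ioc] at hs
    exact (hasDerivAt_ratioK hs.1 hs.2).hasDerivWithinAt
  · intro s hs
    rw [interior_Ioc] at hs
    have h1 : 1 ≤ atanhLog s / s := (one_le_div hs.1).2 (self_le_atanhLog hs.1.le hs.2)
    have h2 : 0 ≤ s * atanhLog s := mul_nonneg hs.1.le (atanhLog_pos hs.1 hs.2).le
    exact div_nonpos_of_nonpos_of_nonneg (by linarith) hs.1.le

theorem monotoneOn_atanhLog : MonotoneOn atanhLog (Ioo 0 1) := by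
  refine monotoneOn_of_hasDerivWithinAt_nonneg (convex_Ioo 0 1)
    (f' := fun s => 1 / (1 - s ^ 2))
    (continuousOn_atanhLog.mono (Ioo_subset_Ioo_left (by norm_num))) ?_ ?_
  · intro s hs
    rw [interior_Ioo] at hs
    exact (hasDerivAt_atanhLog (by linarith [hs.1]) hs.2).hasDerivWithinAt
  · intro s hs
    rw [interior_Ioo] at hs
    have : 0 < 1 - s ^ 2 := by nlinarith [hs.1, hs.2]
    positivity

theorem monotoneOn_atanhLog_div : MonotoneOn (fun s => atanhLog s / s) (Ioo 0 1) := by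
  have hd : ∀ s ∈ Ioo (0 : ℝ) 1, HasDerivAt (fun s => atanhLog s / s)
      ((1 / (1 - s ^ 2) * s - atanhLog s * 1) / s ^ 2) s := fun s hs =>
    (hasDerivAt_atanhLog (by linarith [hs.1]) hs.2).div (hasDerivAt_id s) hs.1.ne'
  refine monotoneOn_of_hasDerivWithinAt_nonneg (convex_Ioo 0 1)
    (f' := fun s => (1 / (1 - s ^ 2) * s - atanhLog s * 1) / s ^ 2)
    (fun s hs => (hd s hs).continuousAt.continuousWithinAt) ?_ ?_
  · intro s hs
    rw [interior_Ioo] at hs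
    exact (hd s hs).hasDerivWithinAt
  · intro s hs
    rw [interior_Ioo] at hs
    have := atanhLog_le hs.1.le hs.2
    have h3 : 1 / (1 - s ^ 2) * s = s / (1 - s ^ 2) := by ring
    exact div_nonneg (by rw [h3]; linarith) (sq_nonneg s)

/-- `K` is subadditive on the multiplicative semigroup `(0, 1)`. The power series of `K` shows
this as well, as it is a positive combination of the functions `1 - s ^ (2 k)`; the proof uses
instead that `s K' s` decreases, so that `K s - K (a s)` decreases to its value `-K a` at
`s = 1`. -/
theorem ratioK_mul_le {a b : ℝ} (ha : a ∈ Ioo (0 : ℝ) 1) (hb : b ∈ Ioo (0 : ℝ) 1) :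
    ratioK (a * b) ≤ ratioK a + ratioK b := by
  have hmem : ∀ s ∈ Ioc (0 : ℝ) 1, a * s ∈ Ioc (0 : ℝ) 1 := fun s hs =>
    ⟨mul_pos ha.1 hs.1, by nlinarith [ha.1, ha.2, hs.1, hs.2]⟩
  have hmem' : ∀ s ∈ Ioo (0 : ℝ) 1, a * s ∈ Ioo (0 : ℝ) 1 := fun s hs =>
    ⟨mul_pos ha.1 hs.1, by nlinarith [ha.1, ha.2, hs.1, hs.2]⟩
  have hanti : AntitoneOn (fun s => ratioK s - ratioK (a * s)) (Ioc 0 1) := by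
    refine antitoneOn_of_hasDerivWithinAt_nonpos (convex_Ioc 0 1)
      (continuousOn_ratioK.sub (continuousOn_ratioK.comp (by fun_prop) hmem))
      (f' := fun s => (1 - atanhLog s / s - s * atanhLog s) / s -
        (1 - atanhLog (a * s) / (a * s) - (a * s) * atanhLog (a * s)) / (a * s) * (a * 1)) ?_ ?_
    · intro s hs
      rw [interior_Ioc] at hs
      have h := hmem' s hs
      exact ((hasDerivAt_ratioK hs.1 hs.2).sub ((hasDerivAt_ratioK h.1 h.2).comp s
        ((hasDerivAt_id s).const_mul a))).hasDerivWithinAt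
    · intro s hs
      rw [interior_Ioc] at hs
      have h := hmem' s hs
      have hle : a * s ≤ s := by nlinarith [ha.1, ha.2, hs.1, hs.2]
      have h1 := monotoneOn_atanhLog_div h hs hle
      have h2 := monotoneOn_atanhLog h hs hle
      simp only at h1
      have h3 : (a * s) * atanhLog (a * s) ≤ s * atanhLog s :=
        mul_le_mul hle h2 (atanhLog_pos h.1 h.2).le hs.1.le
      have h4 : (1 - atanhLog s / s - s * atanhLog s) / s -
        (1 - atanhLog (a * s) / (a * s) - (a * s) * atanhLog (a * s)) / (a * s) * (a * 1)
        = ((1 - atanhLog s / s - s * atanhLog s) -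
        (1 - atanhLog (a * s) / (a * s) - (a * s) * atanhLog (a * s))) / s := by
        have := ha.1.ne'
        have := hs.1.ne'
        field_simp
      rw [h4]
      exact div_nonpos_of_nonpos_of_nonneg (by linarith) hs.1.le
  have := hanti ⟨hb.1, hb.2.le⟩ (right_mem_Ioc.2 one_pos) hb.2.le
  have h1 : ratioK 1 = 0 := by simp [ratioK]
  simp only [mul_one, h1] at this
  linarith

/-! ### The function `W a = a artanh a` -/

/-- `wFun a = a artanh a`. In the coordinates `x = φ a`, `y = φ b` the gradient of `φ (a b)` is
`(W (a b) / W a, W (a b) / W b)`. -/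
noncomputable def wFun (a : ℝ) : ℝ := a * atanhLog a

/-- `E = K / (1 + K)`, which is the reciprocal of the logarithmic derivative `s W' s / W s`
(`hasDerivAt_wFun`). -/
noncomputable def elasE (s : ℝ) : ℝ := ratioK s / (1 + ratioK s)

theorem wFun_pos {a : ℝ} (ha : a ∈ Ioo (0 : ℝ) 1) : 0 < wFun a :=
  mul_pos ha.1 (atanhLog_pos ha.1 ha.2)

theorem elasE_pos {a : ℝ} (ha : a ∈ Ioo (0 : ℝ) 1) : 0 < elasE a := by
  have := ratioK_pos ha.1 ha.2
  unfold elasE; positivity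

theorem hasDerivAt_wFun {a : ℝ} (ha : a ∈ Ioo (0 : ℝ) 1) :
    HasDerivAt wFun (wFun a / (a * elasE a)) a := by
  have hT := hasDerivAt_atanhLog (by linarith [ha.1]) ha.2
  refine ((hasDerivAt_id a).mul hT).congr_deriv ?_
  have h1 : 1 - a ^ 2 ≠ 0 := by nlinarith [ha.1, ha.2]
  have h2 := (atanhLog_pos ha.1 ha.2).ne'
  have h3 := ha.1.ne'
  have h4 : 1 + (1 - a ^ 2) * atanhLog a / a ≠ 0 := by
    have := ratioK_pos ha.1 ha.2
    unfold ratioK at this; positivity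
  have h5 : a + (1 - a ^ 2) * atanhLog a ≠ 0 := by
    intro h
    apply h4
    field_simp
    linarith
  simp only [id, elasE, ratioK, wFun]
  field_simp
  ring

theorem mul_mem_Ioo {a b : ℝ} (ha : a ∈ Ioo (0 : ℝ) 1) (hb : b ∈ Ioo (0 : ℝ) 1) :
    a * b ∈ Ioo (0 : ℝ) 1 :=
  ⟨mul_pos ha.1 hb.1, mul_lt_one_of_nonneg_of_lt_one_left ha.1.le ha.2 hb.2.le⟩

/-- Strict subadditivity of `E`; it says that the Hessian determinant of `φ (a b)`, in the
coordinates `φ a` and `φ b`, is negative. -/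
theorem elasE_mul_lt {a b : ℝ} (ha : a ∈ Ioo (0 : ℝ) 1) (hb : b ∈ Ioo (0 : ℝ) 1) :
    elasE (a * b) < elasE a + elasE b := by
  have h := ratioK_mul_le ha hb
  have h1 := ratioK_pos ha.1 ha.2
  have h2 := ratioK_pos hb.1 hb.2
  have hab := mul_mem_Ioo ha hb
  have h3 := ratioK_pos hab.1 hab.2
  unfold elasE
  calc ratioK (a * b) / (1 + ratioK (a * b))
      ≤ (ratioK a + ratioK b) / (1 + (ratioK a + ratioK b)) := by
        rw [div_le_div_iff₀ (by positivity) (by positivity)]; nlinarith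
    _ = ratioK a / (1 + (ratioK a + ratioK b)) + ratioK b / (1 + (ratioK a + ratioK b)) := by
        rw [add_div]
    _ < _ := by
        apply add_lt_add <;> apply div_lt_div_of_pos_left <;> first | positivity | linarith

theorem elasE_le_elasE {a b : ℝ} (ha : 0 < a) (hb : b < 1) (hab : a ≤ b) : elasE b ≤ elasE a := by
  have h := antitoneOn_ratioK ⟨ha, (hab.trans hb.le)⟩ ⟨ha.trans_le hab, hb.le⟩ hab
  have h1 := ratioK_pos ha (hab.trans_lt hb)
  have h2 := ratioK_pos (ha.trans_le hab) hb
  unfold elasE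
  rw [div_le_div_iff₀ (by positivity) (by positivity)]
  nlinarith

theorem strictMonoOn_wFun : StrictMonoOn wFun (Ioo 0 1) := by
  refine strictMonoOn_of_hasDerivWithinAt_pos (convex_Ioo 0 1)
    (f' := fun a => wFun a / (a * elasE a))
    (fun a ha => (hasDerivAt_wFun ha).continuousAt.continuousWithinAt) ?_ ?_
  · intro a ha
    rw [interior_Ioo] at ha
    exact (hasDerivAt_wFun ha).hasDerivWithinAt
  · intro a ha
    rw [interior_Ioo] at ha
    exact div_pos (wFun_pos ha) (mul_pos ha.1 (elasE_pos ha))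

theorem continuousOn_wFun : ContinuousOn wFun (Ioo 0 1) := fun _ ha =>
  (hasDerivAt_wFun ha).continuousAt.continuousWithinAt

/-- The derivative of `W (a b) / W a` along a curve `(a, b)` in the open unit square. -/
theorem hasDerivAt_wFun_mul_div {α β : ℝ → ℝ} {α' β' t : ℝ} (hα : HasDerivAt α (α t * α') t)
    (hβ : HasDerivAt β (β t * β') t) (ha : α t ∈ Ioo (0 : ℝ) 1) (hb : β t ∈ Ioo (0 : ℝ) 1) :
    HasDerivAt (fun s => wFun (α s * β s) / wFun (α s))
      (wFun (α t * β t) / wFun (α t) *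
        ((α' + β') / elasE (α t * β t) - α' / elasE (α t))) t := by
  have hab := mul_mem_Ioo ha hb
  have h1 := (hasDerivAt_wFun hab).comp t (hα.mul hβ)
  have h2 := (hasDerivAt_wFun ha).comp t hα
  have h3 := (wFun_pos ha).ne'
  refine (h1.div h2 h3).congr_deriv ?_
  have h4 := (elasE_pos ha).ne'
  have h5 := (elasE_pos hab).ne'
  have h6 := ha.1.ne'
  have h7 := hb.1.ne'
  simp only [Function.comp, Pi.mul_apply]
  field_simp

/-- `W (b a) / W a` decreases in `a`; this is the convexity in Mrs. Gerber's lemma. -/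
theorem antitoneOn_wFun_mul_div {b : ℝ} (hb : b ∈ Ioo (0 : ℝ) 1) :
    AntitoneOn (fun a => wFun (a * b) / wFun a) (Ioo 0 1) := by
  have hd : ∀ a ∈ Ioo (0 : ℝ) 1, HasDerivAt (fun a => wFun (a * b) / wFun a)
      (wFun (a * b) / wFun a * ((1 / a + 0) / elasE (a * b) - 1 / a / elasE a)) a := by
    intro a ha
    refine hasDerivAt_wFun_mul_div (α := id) (β := fun _ => b) ?_ ?_ ha hb
    · exact (hasDerivAt_id a).congr_deriv (by simp [ha.1.ne'])
    · exact (hasDerivAt_const a b).congr_deriv (by simp)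
  refine antitoneOn_of_hasDerivWithinAt_nonpos (convex_Ioo 0 1)
    (f' := fun a => wFun (a * b) / wFun a * ((1 / a + 0) / elasE (a * b) - 1 / a / elasE a))
    (fun a ha => (hd a ha).continuousAt.continuousWithinAt) ?_ ?_
  · intro a ha
    rw [interior_Ioo] at ha
    exact (hd a ha).hasDerivWithinAt
  · intro a ha
    rw [interior_Ioo] at ha
    have hab := mul_mem_Ioo ha hb
    have h1 : elasE a ≤ elasE (a * b) :=
      elasE_le_elasE hab.1 ha.2 (by nlinarith [ha.1, hb.2])
    refine mul_nonpos_of_nonneg_of_nonpos (div_pos (wFun_pos hab) (wFun_pos ha)).le ?_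
    rw [add_zero, sub_nonpos]
    have := elasE_pos ha
    have := ha.1
    gcongr

theorem not_wFun_crit_of_lt {a₁ b₁ a₂ b₂ : ℝ} (ha₁ : a₁ ∈ Ioo (0 : ℝ) 1) (hb₁ : b₁ ∈ Ioo (0 : ℝ) 1)
    (ha₂ : a₂ ∈ Ioo (0 : ℝ) 1) (hb₂ : b₂ ∈ Ioo (0 : ℝ) 1)
    (h : wFun (a₁ * b₁) / wFun a₁ = wFun (a₂ * b₂) / wFun a₂)
    (h' : wFun (a₁ * b₁) / wFun b₁ = wFun (a₂ * b₂) / wFun b₂) : ¬ a₁ < a₂ := by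
  intro hlt
  have pa₁ := wFun_pos ha₁
  have pa₂ := wFun_pos ha₂
  have pb₁ := wFun_pos hb₁
  have pb₂ := wFun_pos hb₂
  have p₁ := wFun_pos (mul_mem_Ioo ha₁ hb₁)
  have p₂ := wFun_pos (mul_mem_Ioo ha₂ hb₂)
  set κ := wFun b₁ / wFun a₁ with hκ
  have hκpos : 0 < κ := div_pos pb₁ pa₁
  have e1 : κ * wFun a₁ = wFun b₁ := by rw [hκ]; field_simp
  have e2 : κ * wFun a₂ = wFun b₂ := by
    rw [div_eq_div_iff pa₁.ne' pa₂.ne'] at h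
    rw [div_eq_div_iff pb₁.ne' pb₂.ne'] at h'
    rw [hκ, div_mul_eq_mul_div, div_eq_iff pa₁.ne']
    have : wFun (a₁ * b₁) * (wFun b₁ * wFun a₂) = wFun (a₁ * b₁) * (wFun b₂ * wFun a₁) := by
      calc _ = wFun b₁ * (wFun (a₁ * b₁) * wFun a₂) := by ring
        _ = wFun a₁ * (wFun (a₂ * b₂) * wFun b₁) := by rw [h]; ring
        _ = _ := by rw [← h']; ring
    exact mul_left_cancel₀ p₁.ne' this
  have hsub : Icc a₁ a₂ ⊆ Ioo 0 1 := fun s hs => ⟨ha₁.1.trans_le hs.1, hs.2.trans_lt ha₂.2⟩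
  have hb : b₁ < b₂ := by
    rw [← strictMonoOn_wFun.lt_iff_lt hb₁ hb₂, ← e1, ← e2]
    exact mul_lt_mul_of_pos_left (strictMonoOn_wFun ha₁ ha₂ hlt) hκpos
  have hsubb : Icc b₁ b₂ ⊆ Ioo 0 1 := fun s hs => ⟨hb₁.1.trans_le hs.1, hs.2.trans_lt hb₂.2⟩
  -- the curve `W b = κ W a`, as a graph over the first coordinate
  obtain ⟨g, hgc, hgm, hg⟩ := exists_continuousOn_inverse hb.le (strictMonoOn_wFun.mono hsubb)
    (continuousOn_wFun.mono hsubb)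
  have hmap : ∀ s ∈ Icc a₁ a₂, κ * wFun s ∈ Icc (wFun b₁) (wFun b₂) := by
    intro s hs
    rw [← e1, ← e2]
    constructor <;> gcongr
    · exact strictMonoOn_wFun.monotoneOn ha₁ (hsub hs) hs.1
    · exact strictMonoOn_wFun.monotoneOn (hsub hs) ha₂ hs.2
  have hmapo : ∀ s ∈ Ioo a₁ a₂, κ * wFun s ∈ Ioo (wFun b₁) (wFun b₂) := by
    intro s hs
    rw [← e1, ← e2]
    constructor <;> gcongr
    · exact strictMonoOn_wFun ha₁ (hsub ⟨hs.1.le, hs.2.le⟩) hs.1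
    · exact strictMonoOn_wFun (hsub ⟨hs.1.le, hs.2.le⟩) ha₂ hs.2
  set B : ℝ → ℝ := fun s => g (κ * wFun s) with hB
  have hBmem : ∀ s ∈ Icc a₁ a₂, B s ∈ Ioo (0 : ℝ) 1 := fun s hs => hsubb (hgm (hmap s hs))
  have hWB : ∀ s ∈ Icc a₁ a₂, wFun (B s) = κ * wFun s := fun s hs => hg _ (hmap s hs)
  have hB1 : B a₁ = b₁ := strictMonoOn_wFun.injOn (hBmem _ (left_mem_Icc.2 hlt.le)) hb₁
    (by rw [hWB _ (left_mem_Icc.2 hlt.le), e1])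
  have hB2 : B a₂ = b₂ := strictMonoOn_wFun.injOn (hBmem _ (right_mem_Icc.2 hlt.le)) hb₂
    (by rw [hWB _ (right_mem_Icc.2 hlt.le), e2])
  have hBc : ContinuousOn B (Icc a₁ a₂) :=
    hgc.comp (continuousOn_const.mul (continuousOn_wFun.mono hsub)) hmap
  have hBd : ∀ s ∈ Ioo a₁ a₂, HasDerivAt B (B s * (1 / s * elasE (B s) / elasE s)) s := by
    intro s hs
    have hs' : s ∈ Icc a₁ a₂ := ⟨hs.1.le, hs.2.le⟩
    have hgd : HasDerivAt g (wFun (B s) / (B s * elasE (B s)))⁻¹ (κ * wFun s) := by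
      refine HasDerivAt.of_local_left_inverse ?_ (hasDerivAt_wFun (hBmem s hs')) ?_ ?_
      · exact hgc.continuousAt (Icc_mem_nhds (hmapo s hs).1 (hmapo s hs).2)
      · exact (div_pos (wFun_pos (hBmem s hs'))
          (mul_pos (hBmem s hs').1 (elasE_pos (hBmem s hs')))).ne'
      · filter_upwards [Icc_mem_nhds (hmapo s hs).1 (hmapo s hs).2] with y hy using hg y hy
    refine (hgd.comp s ((hasDerivAt_wFun (hsub hs')).const_mul κ)).congr_deriv ?_
    rw [hWB s hs']
    have h1 := (wFun_pos (hsub hs')).ne'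
    have h2 := (elasE_pos (hsub hs')).ne'
    have h3 := (hsub hs').1.ne'
    have h4 := hκpos.ne'
    field_simp
  have hmono : StrictMonoOn (fun s => wFun (s * B s) / wFun s) (Icc a₁ a₂) := by
    refine strictMonoOn_of_hasDerivWithinAt_pos (convex_Icc a₁ a₂)
      (f' := fun s => wFun (s * B s) / wFun s *
        ((1 / s + 1 / s * elasE (B s) / elasE s) / elasE (s * B s) - 1 / s / elasE s)) ?_ ?_ ?_
    · refine ContinuousOn.div (continuousOn_wFun.comp (continuousOn_id.mul hBc) ?_)
        (continuousOn_wFun.mono hsub) fun s hs => (wFun_pos (hsub hs)).ne'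
      exact fun s hs => mul_mem_Ioo (hsub hs) (hBmem s hs)
    · intro s hs
      rw [interior_Icc] at hs
      have hs' : s ∈ Icc a₁ a₂ := ⟨hs.1.le, hs.2.le⟩
      refine (hasDerivAt_wFun_mul_div (α := id) (β := B) ?_ (hBd s hs) (hsub hs')
        (hBmem s hs')).hasDerivWithinAt
      exact (hasDerivAt_id s).congr_deriv (by simp [(hsub hs').1.ne'])
    · intro s hs
      rw [interior_Icc] at hs
      have hs' : s ∈ Icc a₁ a₂ := ⟨hs.1.le, hs.2.le⟩
      have hsB := mul_mem_Ioo (hsub hs') (hBmem s hs')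
      refine mul_pos (div_pos (wFun_pos hsB) (wFun_pos (hsub hs'))) (sub_pos.2 ?_)
      have hE := elasE_mul_lt (hsub hs') (hBmem s hs')
      have h1 := elasE_pos (hsub hs')
      have h2 := elasE_pos hsB
      have h3 := (hsub hs').1
      rw [lt_div_iff₀ h2]
      have : 1 / s + 1 / s * elasE (B s) / elasE s =
        1 / s / elasE s * (elasE s + elasE (B s)) := by field_simp
      rw [this]
      exact mul_lt_mul_of_pos_left hE (by positivity)
  have := hmono (left_mem_Icc.2 hlt.le) (right_mem_Icc.2 hlt.le) hlt
  simp only [hB1, hB2] at this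
  exact this.ne h

/-- The gradient `(W (a b) / W a, W (a b) / W b)` determines the point `(a, b)`: along a curve
where the ratio of the two entries is constant, each entry is strictly monotone, because `E` is
strictly subadditive. -/
theorem eq_of_wFun_crit {a₁ b₁ a₂ b₂ : ℝ} (ha₁ : a₁ ∈ Ioo (0 : ℝ) 1) (hb₁ : b₁ ∈ Ioo (0 : ℝ) 1)
    (ha₂ : a₂ ∈ Ioo (0 : ℝ) 1) (hb₂ : b₂ ∈ Ioo (0 : ℝ) 1)
    (h : wFun (a₁ * b₁) / wFun a₁ = wFun (a₂ * b₂) / wFun a₂)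
    (h' : wFun (a₁ * b₁) / wFun b₁ = wFun (a₂ * b₂) / wFun b₂) : a₁ = a₂ ∧ b₁ = b₂ := by
  constructor
  · exact le_antisymm (not_lt.1 (not_wFun_crit_of_lt ha₂ hb₂ ha₁ hb₁ h.symm h'.symm))
      (not_lt.1 (not_wFun_crit_of_lt ha₁ hb₁ ha₂ hb₂ h h'))
  · rw [mul_comm a₁, mul_comm a₂] at h h'
    exact le_antisymm (not_lt.1 (not_wFun_crit_of_lt hb₂ ha₂ hb₁ ha₁ h'.symm h.symm))
      (not_lt.1 (not_wFun_crit_of_lt hb₁ ha₁ hb₂ ha₂ h' h))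

/-! ### Binary entropy as a function of the bias -/

/-- The entropy of a `±1`-valued random variable with mean `a`. The mean of the product of two
independent such variables is the product of the means. -/
noncomputable def biasEntropy (a : ℝ) : ℝ := Real.binEntropy ((1 - a) / 2)

theorem biasEntropy_neg (a : ℝ) : biasEntropy (-a) = biasEntropy a := by
  unfold biasEntropy
  rw [← Real.binEntropy_one_sub]; congr 1; ring

theorem biasEntropy_abs (a : ℝ) : biasEntropy |a| = biasEntropy a := by
  rcases abs_choice a with h | h <;> rw [h]
  exact biasEntropy_neg a

theorem biasEntropy_zero : biasEntropy 0 = Real.log 2 := by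
  rw [biasEntropy, show ((1 - 0) / 2 : ℝ) = 2⁻¹ by norm_num, Real.binEntropy_two_inv]

theorem biasEntropy_one : biasEntropy 1 = 0 := by simp [biasEntropy]

theorem continuous_biasEntropy : Continuous biasEntropy := by
  unfold biasEntropy; fun_prop

theorem strictAntiOn_biasEntropy : StrictAntiOn biasEntropy (Icc 0 1) := by
  intro a ha b hb hab
  refine Real.binEntropy_strictMonoOn ?_ ?_ ?_
  · constructor <;> linarith [hb.1, hb.2]
  · constructor <;> linarith [ha.1, ha.2]
  · linarith

theorem hasDerivAt_biasEntropy {a : ℝ} (h0 : -1 < a) (h1 : a < 1) :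
    HasDerivAt biasEntropy (-atanhLog a) a := by
  have hp : (1 - a) / 2 ≠ 0 := by linarith
  have hp1 : (1 - a) / 2 ≠ 1 := by intro h; linarith
  have hd : HasDerivAt (fun a : ℝ => (1 - a) / 2) (-1 / 2) a :=
    ((hasDerivAt_id a).const_sub 1).div_const 2
  refine ((Real.hasDerivAt_binEntropy hp hp1).comp a hd).congr_deriv ?_
  rw [show 1 - (1 - a) / 2 = (1 + a) / 2 by ring, Real.log_div (by linarith) (by norm_num),
    Real.log_div (by linarith) (by norm_num), atanhLog]
  ring

theorem exists_bias : ∃ ψ : ℝ → ℝ, ContinuousOn ψ (Icc 0 (Real.log 2)) ∧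
    MapsTo ψ (Icc 0 (Real.log 2)) (Icc 0 1) ∧
    ∀ x ∈ Icc 0 (Real.log 2), biasEntropy (ψ x) = x := by
  obtain ⟨g, h1, h2, h3⟩ := exists_continuousOn_inverse (p := 0) (q := 2⁻¹) (by norm_num)
    Real.binEntropy_strictMonoOn Real.binEntropy_continuous.continuousOn
  rw [Real.binEntropy_zero, Real.binEntropy_two_inv] at h1 h2 h3
  refine ⟨fun x => 1 - 2 * g x, by fun_prop, fun x hx => ?_, fun x hx => ?_⟩
  · have := h2 hx
    constructor <;> linarith [this.1, this.2]
  · rw [biasEntropy, show (1 - (1 - 2 * g x)) / 2 = g x by ring, h3 x hx]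

/-- The bias in `[0, 1]` of a binary distribution with entropy `x ∈ [0, log 2]`, the inverse
function of `biasEntropy`. -/
noncomputable def bias : ℝ → ℝ := exists_bias.choose

theorem continuousOn_bias : ContinuousOn bias (Icc 0 (Real.log 2)) := exists_bias.choose_spec.1

theorem bias_mem {x : ℝ} (hx : x ∈ Icc 0 (Real.log 2)) : bias x ∈ Icc (0 : ℝ) 1 :=
  exists_bias.choose_spec.2.1 hx

theorem biasEntropy_bias {x : ℝ} (hx : x ∈ Icc 0 (Real.log 2)) : biasEntropy (bias x) = x :=
  exists_bias.choose_spec.2.2 x hx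

theorem biasEntropy_mem {a : ℝ} (ha : a ∈ Icc (-1 : ℝ) 1) :
    biasEntropy a ∈ Icc 0 (Real.log 2) :=
  ⟨Real.binEntropy_nonneg (by linarith [ha.2]) (by linarith [ha.1]), Real.binEntropy_le_log_two⟩

theorem bias_biasEntropy {a : ℝ} (ha : a ∈ Icc (-1 : ℝ) 1) : bias (biasEntropy a) = |a| := by
  have h := biasEntropy_mem ha
  refine strictAntiOn_biasEntropy.injOn (bias_mem h) ⟨abs_nonneg a, abs_le.2 ha⟩ ?_
  rw [biasEntropy_bias h, biasEntropy_abs]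

theorem bias_zero : bias 0 = 1 := by
  rw [← biasEntropy_one, bias_biasEntropy (by norm_num)]; norm_num

theorem bias_log_two : bias (Real.log 2) = 0 := by
  rw [← biasEntropy_zero, bias_biasEntropy (by norm_num)]; norm_num

theorem strictAntiOn_bias : StrictAntiOn bias (Icc 0 (Real.log 2)) := by
  intro x hx y hy hxy
  rw [← strictAntiOn_biasEntropy.lt_iff_gt (bias_mem hx) (bias_mem hy), biasEntropy_bias hx,
    biasEntropy_bias hy]
  exact hxy

theorem log_two_pos : 0 < Real.log 2 := Real.log_pos one_lt_two

theorem zero_mem_Icc : (0 : ℝ) ∈ Icc 0 (Real.log 2) := left_mem_Icc.2 log_two_pos.le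

theorem log_two_mem : Real.log 2 ∈ Icc 0 (Real.log 2) := right_mem_Icc.2 log_two_pos.le

theorem bias_mem_Ioo {x : ℝ} (hx : x ∈ Ioo 0 (Real.log 2)) : bias x ∈ Ioo (0 : ℝ) 1 := by
  have hx' := Ioo_subset_Icc_self hx
  constructor
  · rw [← bias_log_two]; exact strictAntiOn_bias hx' log_two_mem hx.2
  · rw [← bias_zero]; exact strictAntiOn_bias zero_mem_Icc hx' hx.1

theorem hasDerivAt_bias {x : ℝ} (hx : x ∈ Ioo 0 (Real.log 2)) :
    HasDerivAt bias (bias x * (-1 / wFun (bias x))) x := by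
  have hb := bias_mem_Ioo hx
  have hT := atanhLog_pos hb.1 hb.2
  have h : HasDerivAt bias (-atanhLog (bias x))⁻¹ x := by
    refine HasDerivAt.of_local_left_inverse
      (continuousOn_bias.continuousAt (Icc_mem_nhds hx.1 hx.2))
      (hasDerivAt_biasEntropy (by linarith [hb.1]) hb.2) (neg_ne_zero.2 hT.ne') ?_
    filter_upwards [Icc_mem_nhds hx.1 hx.2] with y hy using biasEntropy_bias hy
  refine h.congr_deriv ?_
  have := hb.1.ne'
  have := hT.ne'
  unfold wFun
  field_simp

/-! ### Sums of two independent bits -/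

/-- The entropy of the sum in `ℤ/2` of two independent bits with entropies `x` and `y`, meaningful
for `x, y ∈ [0, log 2]`. -/
noncomputable def bitSum (x y : ℝ) : ℝ := biasEntropy (bias x * bias y)

theorem bitSum_comm (x y : ℝ) : bitSum x y = bitSum y x := by
  unfold bitSum; rw [mul_comm]

theorem bitSum_biasEntropy {r s : ℝ} (hr : r ∈ Icc (-1 : ℝ) 1) (hs : s ∈ Icc (-1 : ℝ) 1) :
    bitSum (biasEntropy r) (biasEntropy s) = biasEntropy (r * s) := by
  rw [bitSum, bias_biasEntropy hr, bias_biasEntropy hs, ← abs_mul, biasEntropy_abs]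

theorem bitSum_zero_left {y : ℝ} (hy : y ∈ Icc 0 (Real.log 2)) : bitSum 0 y = y := by
  rw [bitSum, bias_zero, one_mul, biasEntropy_bias hy]

theorem bitSum_zero_right {x : ℝ} (hx : x ∈ Icc 0 (Real.log 2)) : bitSum x 0 = x := by
  rw [bitSum_comm, bitSum_zero_left hx]

theorem bitSum_log_two_left (y : ℝ) : bitSum (Real.log 2) y = Real.log 2 := by
  rw [bitSum, bias_log_two, zero_mul, biasEntropy_zero]

theorem bitSum_log_two_right (x : ℝ) : bitSum x (Real.log 2) = Real.log 2 := by
  rw [bitSum_comm, bitSum_log_two_left]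

theorem mul_bias_mem {x y : ℝ} (hx : x ∈ Icc 0 (Real.log 2)) (hy : y ∈ Icc 0 (Real.log 2)) :
    bias x * bias y ∈ Icc (0 : ℝ) 1 :=
  ⟨mul_nonneg (bias_mem hx).1 (bias_mem hy).1,
    mul_le_one₀ (bias_mem hx).2 (bias_mem hy).1 (bias_mem hy).2⟩

theorem bitSum_mem {x y : ℝ} (hx : x ∈ Icc 0 (Real.log 2)) (hy : y ∈ Icc 0 (Real.log 2)) :
    bitSum x y ∈ Icc 0 (Real.log 2) :=
  biasEntropy_mem (Icc_subset_Icc_left (by norm_num) (mul_bias_mem hx hy))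

theorem bitSum_mono_left {x x' y : ℝ} (hx : x ∈ Icc 0 (Real.log 2)) (hx' : x' ∈ Icc 0 (Real.log 2))
    (hy : y ∈ Icc 0 (Real.log 2)) (h : x ≤ x') : bitSum x y ≤ bitSum x' y := by
  refine strictAntiOn_biasEntropy.antitoneOn (mul_bias_mem hx' hy) (mul_bias_mem hx hy) ?_
  exact mul_le_mul_of_nonneg_right (strictAntiOn_bias.antitoneOn hx hx' h) (bias_mem hy).1

theorem bitSum_mono_right {x y y' : ℝ} (hx : x ∈ Icc 0 (Real.log 2)) (hy : y ∈ Icc 0 (Real.log 2))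
    (hy' : y' ∈ Icc 0 (Real.log 2)) (h : y ≤ y') : bitSum x y ≤ bitSum x y' := by
  rw [bitSum_comm x, bitSum_comm x]; exact bitSum_mono_left hy hy' hx h

theorem le_bitSum_left {x y : ℝ} (hx : x ∈ Icc 0 (Real.log 2)) (hy : y ∈ Icc 0 (Real.log 2)) :
    x ≤ bitSum x y := by
  simpa [bitSum_zero_right hx] using bitSum_mono_right hx zero_mem_Icc hy hy.1

theorem le_bitSum_right {x y : ℝ} (hx : x ∈ Icc 0 (Real.log 2)) (hy : y ∈ Icc 0 (Real.log 2)) :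
    y ≤ bitSum x y := by
  rw [bitSum_comm]; exact le_bitSum_left hy hx

theorem continuousOn_bitSum : ContinuousOn (fun p : ℝ × ℝ => bitSum p.1 p.2)
    (Icc 0 (Real.log 2) ×ˢ Icc 0 (Real.log 2)) := by
  refine continuous_biasEntropy.comp_continuousOn (ContinuousOn.mul ?_ ?_)
  · exact continuousOn_bias.comp continuousOn_fst fun p hp => hp.1
  · exact continuousOn_bias.comp continuousOn_snd fun p hp => hp.2

/-- The derivative of `bitSum` along a line. -/
theorem hasDerivAt_bitSum_line {x y v w t : ℝ} (hx : x + t * v ∈ Ioo 0 (Real.log 2))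
    (hy : y + t * w ∈ Ioo 0 (Real.log 2)) :
    HasDerivAt (fun t => bitSum (x + t * v) (y + t * w))
      (wFun (bias (x + t * v) * bias (y + t * w)) / wFun (bias (x + t * v)) * v +
        wFun (bias (x + t * v) * bias (y + t * w)) / wFun (bias (y + t * w)) * w) t := by
  have ha := bias_mem_Ioo hx
  have hb := bias_mem_Ioo hy
  have hab := mul_mem_Ioo ha hb
  have h1 : HasDerivAt (fun t => x + t * v) v t := by
    simpa using ((hasDerivAt_id t).mul_const v).const_add x
  have h2 : HasDerivAt (fun t => y + t * w) w t := by
    simpa using ((hasDerivAt_id t).mul_const w).const_add y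
  have h3 := ((hasDerivAt_bias hx).comp t h1).mul ((hasDerivAt_bias hy).comp t h2)
  refine ((hasDerivAt_biasEntropy (by linarith [hab.1]) hab.2).comp t h3).congr_deriv ?_
  have e1 := (wFun_pos ha).ne'
  have e2 := (wFun_pos hb).ne'
  simp only [Function.comp]
  rw [wFun.eq_1 (bias (x + t * v) * bias (y + t * w))]
  field_simp
  ring

/-- Mrs. Gerber's lemma. -/
theorem convexOn_bitSum {y : ℝ} (hy : y ∈ Icc 0 (Real.log 2)) :
    ConvexOn ℝ (Icc 0 (Real.log 2)) fun x => bitSum x y := by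
  have hconv : Convex ℝ (Icc 0 (Real.log 2)) := convex_Icc _ _
  rcases eq_or_lt_of_le hy.1 with h0 | h0
  · subst h0
    have h : ConvexOn ℝ (Icc 0 (Real.log 2)) fun x : ℝ => x := convexOn_id hconv
    exact h.congr fun x hx => (bitSum_zero_right hx).symm
  rcases eq_or_lt_of_le hy.2 with h1 | h1
  · subst h1
    exact (convexOn_const _ hconv).congr fun x hx => (bitSum_log_two_right x).symm
  have hd : ∀ x ∈ Ioo 0 (Real.log 2), HasDerivAt (fun x => bitSum x y)
      (wFun (bias x * bias y) / wFun (bias x)) x := by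
    intro x hx
    have := hasDerivAt_bitSum_line (x := 0) (y := y) (v := 1) (w := 0) (t := x)
      (by simpa using hx) (by simpa using ⟨h0, h1⟩)
    simpa using this
  refine MonotoneOn.convexOn_of_deriv hconv ?_ ?_ ?_
  · exact continuousOn_bitSum.comp (f := fun x => (x, y)) (by fun_prop) fun x hx => ⟨hx, hy⟩
  · intro x hx
    rw [interior_Icc] at hx
    exact (hd x hx).differentiableAt.differentiableWithinAt
  · rw [interior_Icc]
    intro x hx x' hx' hxx
    rw [(hd x hx).deriv, (hd x' hx').deriv]
    exact antitoneOn_wFun_mul_div (bias_mem_Ioo ⟨h0, h1⟩) (bias_mem_Ioo hx') (bias_mem_Ioo hx)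
      (strictAntiOn_bias.antitoneOn (Ioo_subset_Icc_self hx) (Ioo_subset_Icc_self hx') hxx)

theorem convexOn_bitSum_sub {y : ℝ} (hy : y ∈ Icc 0 (Real.log 2)) :
    ConvexOn ℝ (Icc 0 (Real.log 2)) fun x => bitSum x y - x :=
  (convexOn_bitSum hy).sub (concaveOn_id (convex_Icc _ _))

/-- The slopes of `bitSum` are at most one: `bitSum x y - x` is convex and non-negative, and
vanishes at the right end point. -/
theorem antitoneOn_bitSum_sub {y : ℝ} (hy : y ∈ Icc 0 (Real.log 2)) :
    AntitoneOn (fun x => bitSum x y - x) (Icc 0 (Real.log 2)) := by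
  intro x hx x' hx' hxx
  have hc := (convexOn_bitSum_sub hy).2 hx log_two_mem
  simp only
  rcases eq_or_lt_of_le hx.2 with h | h
  · have : x' = x := le_antisymm (h ▸ hx'.2) hxx
    rw [this]
  have hpos : 0 < Real.log 2 - x := sub_pos.2 h
  have := hc (a := (Real.log 2 - x') / (Real.log 2 - x)) (b := (x' - x) / (Real.log 2 - x))
    (div_nonneg (by linarith [hx'.2]) hpos.le) (div_nonneg (by linarith) hpos.le)
    (by field_simp; ring)
  simp only [smul_eq_mul, bitSum_log_two_left, sub_self, mul_zero, add_zero] at this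
  have e : (Real.log 2 - x') / (Real.log 2 - x) * x + (x' - x) / (Real.log 2 - x) * Real.log 2
      = x' := by field_simp; ring
  rw [e] at this
  refine this.trans (mul_le_of_le_one_left (sub_nonneg.2 (le_bitSum_left hx hy)) ?_)
  rw [div_le_one hpos]; linarith

theorem bitSum_add_le {x y d : ℝ} (hx : x ∈ Icc 0 (Real.log 2)) (hy : y ∈ Icc 0 (Real.log 2))
    (hd : 0 ≤ d) (hyd : y + d ≤ Real.log 2) : bitSum x (y + d) ≤ bitSum x y + d := by
  have := antitoneOn_bitSum_sub hx hy ⟨by linarith [hy.1], hyd⟩ (by linarith : y ≤ y + d)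
  simp only [bitSum_comm _ x] at this
  linarith

/-! ### Two pairs of bits -/

/-- The right side of `bitSumSplit_le`: the entropies `s` and `t` are split
between two levels, the first of which is filled before the second one is used. -/
noncomputable def bitSumSplit (s t : ℝ) : ℝ :=
  bitSum (min s (Real.log 2)) (min t (Real.log 2)) +
    bitSum (max (s - Real.log 2) 0) (max (t - Real.log 2) 0)

theorem bitSumSplit_comm (s t : ℝ) : bitSumSplit s t = bitSumSplit t s := by
  rw [bitSumSplit, bitSumSplit, bitSum_comm, bitSum_comm (max _ _)]

theorem bitSumSplit_le_of_boundary {u₁ u₂ v₁ v₂ : ℝ} (hu₂ : u₂ ∈ Icc 0 (Real.log 2))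
    (hv₁ : v₁ ∈ Icc 0 (Real.log 2)) (hv₂ : v₂ ∈ Icc 0 (Real.log 2))
    (h : u₁ = 0 ∨ u₁ = Real.log 2) :
    bitSumSplit (u₁ + u₂) (v₁ + v₂) ≤ bitSum u₁ v₁ + bitSum u₂ v₂ := by
  unfold bitSumSplit
  rcases h with rfl | rfl
  · rw [bitSum_zero_left hv₁, zero_add, min_eq_left hu₂.2, max_eq_right (sub_nonpos.2 hu₂.2)]
    rcases le_total (v₁ + v₂) (Real.log 2) with h | h
    · rw [min_eq_left h, max_eq_right (sub_nonpos.2 h), bitSum_zero_left zero_mem_Icc, add_comm v₁]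
      linarith [bitSum_add_le hu₂ hv₂ hv₁.1 (by linarith)]
    · rw [min_eq_right h, max_eq_left (sub_nonneg.2 h), bitSum_log_two_right,
        bitSum_zero_left ⟨sub_nonneg.2 h, by linarith [hv₁.2, hv₂.2]⟩]
      linarith [le_bitSum_right hu₂ hv₂]
  · rw [min_eq_right (by linarith [hu₂.1]), bitSum_log_two_left, bitSum_log_two_left,
      add_sub_cancel_left, max_eq_left hu₂.1]
    gcongr
    exact bitSum_mono_right hu₂ ⟨le_max_right _ _, max_le (by linarith [hv₁.2, hv₂.2])
      log_two_pos.le⟩ hv₂ (max_le (by linarith [hv₁.2]) hv₂.1)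

theorem eventually_line_mem {x : ℝ} (v : ℝ) (hx : x ∈ Ioo 0 (Real.log 2)) :
    ∀ᶠ t in 𝓝 (0 : ℝ), x + t * v ∈ Ioo 0 (Real.log 2) := by
  have : ContinuousAt (fun t : ℝ => x + t * v) 0 := by fun_prop
  exact this.eventually_mem (by simpa using Ioo_mem_nhds hx.1 hx.2)

theorem deriv_eq_of_eventually_le {x₁ x₂ y₁ y₂ v w : ℝ} (hx₁ : x₁ ∈ Ioo 0 (Real.log 2))
    (hx₂ : x₂ ∈ Ioo 0 (Real.log 2)) (hy₁ : y₁ ∈ Ioo 0 (Real.log 2))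
    (hy₂ : y₂ ∈ Ioo 0 (Real.log 2))
    (hmin : ∀ᶠ t in 𝓝 (0 : ℝ), bitSum x₁ y₁ + bitSum x₂ y₂ ≤
      bitSum (x₁ + t * v) (y₁ + t * w) + bitSum (x₂ + t * (-v)) (y₂ + t * (-w))) :
    wFun (bias x₁ * bias y₁) / wFun (bias x₁) * v + wFun (bias x₁ * bias y₁) / wFun (bias y₁) * w =
    wFun (bias x₂ * bias y₂) / wFun (bias x₂) * v +
      wFun (bias x₂ * bias y₂) / wFun (bias y₂) * w := by
  have h1 := hasDerivAt_bitSum_line (x := x₁) (y := y₁) (v := v) (w := w) (t := 0)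
    (by simpa using hx₁) (by simpa using hy₁)
  have h2 := hasDerivAt_bitSum_line (x := x₂) (y := y₂) (v := -v) (w := -w) (t := 0)
    (by simpa using hx₂) (by simpa using hy₂)
  have hloc : IsLocalMin (fun t => bitSum (x₁ + t * v) (y₁ + t * w) +
      bitSum (x₂ + t * (-v)) (y₂ + t * (-w))) 0 := by
    filter_upwards [hmin] with t ht
    simpa using ht
  have := hloc.hasDerivAt_eq_zero (h1.add h2)
  simp only [zero_mul, add_zero] at this
  linarith

/-- There is no interior minimum of the sum over two levels: the gradients would agree, so that
the two points would coincide, and the Hessian is indefinite. -/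
theorem no_interior_min {x₁ x₂ y₁ y₂ : ℝ} (hx₁ : x₁ ∈ Ioo 0 (Real.log 2))
    (hx₂ : x₂ ∈ Ioo 0 (Real.log 2)) (hy₁ : y₁ ∈ Ioo 0 (Real.log 2))
    (hy₂ : y₂ ∈ Ioo 0 (Real.log 2))
    (hmin : ∀ v w : ℝ, ∀ᶠ t in 𝓝 (0 : ℝ), bitSum x₁ y₁ + bitSum x₂ y₂ ≤
      bitSum (x₁ + t * v) (y₁ + t * w) + bitSum (x₂ + t * (-v)) (y₂ + t * (-w))) : False := by
  have ha := bias_mem_Ioo hx₁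
  have hb := bias_mem_Ioo hy₁
  have d1 := deriv_eq_of_eventually_le hx₁ hx₂ hy₁ hy₂ (hmin 1 0)
  have d2 := deriv_eq_of_eventually_le hx₁ hx₂ hy₁ hy₂ (hmin 0 1)
  simp only [mul_one, mul_zero, add_zero, zero_add] at d1 d2
  obtain ⟨ea, eb⟩ := eq_of_wFun_crit ha hb (bias_mem_Ioo hx₂) (bias_mem_Ioo hy₂) d1 d2
  have ex : x₁ = x₂ := strictAntiOn_bias.injOn (Ioo_subset_Icc_self hx₁)
    (Ioo_subset_Icc_self hx₂) ea
  have ey : y₁ = y₂ := strictAntiOn_bias.injOn (Ioo_subset_Icc_self hy₁)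
    (Ioo_subset_Icc_self hy₂) eb
  subst ex ey
  set a := bias x₁
  set b := bias y₁
  -- the direction in which `log a` and `log b` grow at the rates `E a` and `E b`
  set v := -(wFun a * elasE a) with hv
  set w := -(wFun b * elasE b) with hw
  have pa := wFun_pos ha
  have pb := wFun_pos hb
  have pab := wFun_pos (mul_mem_Ioo ha hb)
  have hα : HasDerivAt (fun t => bias (x₁ + t * v)) (bias (x₁ + 0 * v) * elasE a) 0 := by
    have h1 : HasDerivAt (fun t => x₁ + t * v) v 0 := by
      simpa using ((hasDerivAt_id (0 : ℝ)).mul_const v).const_add x₁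
    refine ((hasDerivAt_bias (by simpa using hx₁)).comp (0 : ℝ) h1).congr_deriv ?_
    simp only [zero_mul, add_zero, hv]
    change a * (-1 / wFun a) * _ = a * _
    field_simp
  have hβ : HasDerivAt (fun t => bias (y₁ + t * w)) (bias (y₁ + 0 * w) * elasE b) 0 := by
    have h1 : HasDerivAt (fun t => y₁ + t * w) w 0 := by
      simpa using ((hasDerivAt_id (0 : ℝ)).mul_const w).const_add y₁
    refine ((hasDerivAt_bias (by simpa using hy₁)).comp (0 : ℝ) h1).congr_deriv ?_
    simp only [zero_mul, add_zero, hw]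
    change b * (-1 / wFun b) * _ = b * _
    field_simp
  have hg1 := hasDerivAt_wFun_mul_div hα hβ (by simpa using ha) (by simpa using hb)
  have hg2 := hasDerivAt_wFun_mul_div hβ hα (by simpa using hb) (by simpa using ha)
  refine not_eventually_two_mul_le (γ := fun t => bitSum (x₁ + t * v) (y₁ + t * w))
    (g := fun t => wFun (bias (x₁ + t * v) * bias (y₁ + t * w)) / wFun (bias (x₁ + t * v)) * v +
        wFun (bias (y₁ + t * w) * bias (x₁ + t * v)) / wFun (bias (y₁ + t * w)) * w)
    ?_ ((hg1.mul_const v).add (hg2.mul_const w)) ?_ ?_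
  · filter_upwards [eventually_line_mem v hx₁, eventually_line_mem w hy₁] with t h1 h2
    refine (hasDerivAt_bitSum_line h1 h2).congr_deriv ?_
    rw [mul_comm (bias (y₁ + t * w))]
  · simp only [zero_mul, add_zero]
    change wFun (a * b) / wFun a * ((elasE a + elasE b) / elasE (a * b) - elasE a / elasE a) * v +
      wFun (b * a) / wFun b * ((elasE b + elasE a) / elasE (b * a) - elasE b / elasE b) * w < 0
    have qa := elasE_pos ha
    have qb := elasE_pos hb
    have qab := elasE_pos (mul_mem_Ioo ha hb)
    have e : wFun (a * b) / wFun a * ((elasE a + elasE b) / elasE (a * b) - elasE a / elasE a) * v +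
      wFun (b * a) / wFun b * ((elasE b + elasE a) / elasE (b * a) - elasE b / elasE b) * w =
      -((elasE a + elasE b) * wFun (a * b) * ((elasE a + elasE b) / elasE (a * b) - 1)) := by
      rw [mul_comm b a, div_self qa.ne', div_self qb.ne', hv, hw]
      field_simp
      ring
    rw [e, neg_lt_zero]
    refine mul_pos (mul_pos (by positivity) pab) (sub_pos.2 ?_)
    rw [one_lt_div qab]
    exact elasE_mul_lt ha hb
  · filter_upwards [hmin v w] with t ht
    simp only [zero_mul, add_zero]
    calc 2 * bitSum x₁ y₁ = bitSum x₁ y₁ + bitSum x₁ y₁ := two_mul _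
      _ ≤ _ := ht
      _ = _ := by simp only [mul_neg, neg_mul]

/-- Concentrating the entropies of two independent pairs of bits on as few bits as possible
minimizes the total entropy of the sums. -/
theorem bitSumSplit_le {u₁ u₂ v₁ v₂ : ℝ} (hu₁ : u₁ ∈ Icc 0 (Real.log 2))
    (hu₂ : u₂ ∈ Icc 0 (Real.log 2)) (hv₁ : v₁ ∈ Icc 0 (Real.log 2))
    (hv₂ : v₂ ∈ Icc 0 (Real.log 2)) :
    bitSumSplit (u₁ + u₂) (v₁ + v₂) ≤ bitSum u₁ v₁ + bitSum u₂ v₂ := by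
  set s := u₁ + u₂ with hs
  set t := v₁ + v₂ with ht
  set L := Real.log 2 with hL
  set R : Set (ℝ × ℝ) := {p | (p.1 ∈ Icc 0 L ∧ p.2 ∈ Icc 0 L) ∧ s - p.1 ∈ Icc 0 L ∧
    t - p.2 ∈ Icc 0 L} with hR
  have hRc : IsCompact R := by
    have hclosed : IsClosed {p : ℝ × ℝ | s - p.1 ∈ Icc 0 L ∧ t - p.2 ∈ Icc 0 L} :=
      (isClosed_Icc.preimage (by fun_prop : Continuous fun p : ℝ × ℝ => s - p.1)).inter
        (isClosed_Icc.preimage (by fun_prop : Continuous fun p : ℝ × ℝ => t - p.2))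
    exact (isCompact_Icc.prod isCompact_Icc).inter_right hclosed
  have hcont : ContinuousOn (fun p : ℝ × ℝ => bitSum p.1 p.2 + bitSum (s - p.1) (t - p.2)) R := by
    refine ContinuousOn.add (continuousOn_bitSum.mono fun p hp => hp.1) ?_
    exact continuousOn_bitSum.comp (f := fun p : ℝ × ℝ => (s - p.1, t - p.2)) (by fun_prop)
      fun p hp => hp.2
  have hmem : (u₁, v₁) ∈ R := by
    refine ⟨⟨hu₁, hv₁⟩, ?_, ?_⟩
    · simpa [hs] using hu₂
    · simpa [ht] using hv₂
  obtain ⟨⟨x, y⟩, hxy, hmin⟩ := hRc.exists_isMinOn ⟨_, hmem⟩ hcont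
  have hle := hmin hmem
  simp only [mem_ofPred_eq] at hle
  have e1 : s - u₁ = u₂ := by rw [hs]; ring
  have e2 : t - v₁ = v₂ := by rw [ht]; ring
  rw [e1, e2] at hle
  refine le_trans ?_ hle
  obtain ⟨⟨hx, hy⟩, hx', hy'⟩ := hxy
  simp only at hx hy hx' hy'
  have es : s = x + (s - x) := by ring
  have et : t = y + (t - y) := by ring
  by_cases bx : x = 0 ∨ x = L
  · have := bitSumSplit_le_of_boundary hx' hy hy' bx
    rwa [← es, ← et] at this
  by_cases by' : y = 0 ∨ y = L
  · have := bitSumSplit_le_of_boundary hy' hx hx' by'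
    rwa [← es, ← et, bitSumSplit_comm, bitSum_comm y, bitSum_comm (t - y)] at this
  by_cases bx' : s - x = 0 ∨ s - x = L
  · have := bitSumSplit_le_of_boundary hx hy' hy bx'
    rwa [sub_add_cancel, sub_add_cancel, add_comm (bitSum _ _)] at this
  by_cases by'' : t - y = 0 ∨ t - y = L
  · have := bitSumSplit_le_of_boundary hy hx' hx by''
    rwa [sub_add_cancel, sub_add_cancel, add_comm (bitSum _ _), bitSumSplit_comm, bitSum_comm y,
      bitSum_comm (t - y)] at this
  have toIoo : ∀ z : ℝ, z ∈ Icc 0 L → ¬ (z = 0 ∨ z = L) → z ∈ Ioo 0 L := fun z hz h =>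
    ⟨lt_of_le_of_ne hz.1 fun e => h (Or.inl e.symm), lt_of_le_of_ne hz.2 fun e => h (Or.inr e)⟩
  have jx := toIoo x hx bx
  have jy := toIoo y hy by'
  have jx' := toIoo _ hx' bx'
  have jy' := toIoo _ hy' by''
  refine (no_interior_min jx jx' jy jy' fun v w => ?_).elim
  filter_upwards [eventually_line_mem v jx, eventually_line_mem w jy,
    eventually_line_mem (-v) jx', eventually_line_mem (-w) jy'] with r h1 h2 h3 h4
  have e3 : s - (x + r * v) = s - x + r * (-v) := by ring
  have e4 : t - (y + r * w) = t - y + r * (-w) := by ring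
  have hin : (x + r * v, y + r * w) ∈ R :=
    ⟨⟨Ioo_subset_Icc_self h1, Ioo_subset_Icc_self h2⟩,
      by simp only [e3]; exact Ioo_subset_Icc_self h3,
      by simp only [e4]; exact Ioo_subset_Icc_self h4⟩
  have := hmin hin
  simp only [mem_ofPred_eq, e3, e4] at this
  exact this

/-! ### Convexity of compositions -/

theorem convexOn_comp_of_monotoneOn {s t : Set ℝ} {f g : ℝ → ℝ} (hg : ConvexOn ℝ t g)
    (hm : MonotoneOn g t) (hf : ConvexOn ℝ s f) (hst : MapsTo f s t) :
    ConvexOn ℝ s fun x => g (f x) := by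
  refine ⟨hf.1, fun x hx y hy a b ha hb hab => ?_⟩
  refine (hm (hst (hf.1 hx hy ha hb hab)) (hg.1 (hst hx) (hst hy) ha hb hab)
    (hf.2 hx hy ha hb hab)).trans ?_
  exact hg.2 (hst hx) (hst hy) ha hb hab

theorem convexOn_comp_of_antitoneOn {s t : Set ℝ} {f g : ℝ → ℝ} (hg : ConvexOn ℝ t g)
    (hm : AntitoneOn g t) (hf : ConcaveOn ℝ s f) (hst : MapsTo f s t) :
    ConvexOn ℝ s fun x => g (f x) := by
  refine ⟨hf.1, fun x hx y hy a b ha hb hab => ?_⟩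
  refine (hm (hg.1 (hst hx) (hst hy) ha hb hab) (hst (hf.1 hx hy ha hb hab))
    (hf.2 hx hy ha hb hab)).trans ?_
  exact hg.2 (hst hx) (hst hy) ha hb hab

/-! ### The minimal entropy function of a group of order `2 ^ n` -/

/-- The minimal entropy of a sum of two independent variables with entropies `x` and `y` in a
group of order `2 ^ n`, meaningful for `x, y ∈ [0, n log 2]`. Both entropies are distributed over
`n` bits, each of which is filled before the next one is used, and the bits are added
separately. -/
noncomputable def levelSum : ℕ → ℝ → ℝ → ℝ
  | 0, _, _ => 0
  | n + 1, x, y => bitSum (min x (Real.log 2)) (min y (Real.log 2)) +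
      levelSum n (max (x - Real.log 2) 0) (max (y - Real.log 2) 0)

theorem levelSum_succ (n : ℕ) (x y : ℝ) : levelSum (n + 1) x y =
    bitSum (min x (Real.log 2)) (min y (Real.log 2)) +
      levelSum n (max (x - Real.log 2) 0) (max (y - Real.log 2) 0) := rfl

theorem levelSum_comm (n : ℕ) (x y : ℝ) : levelSum n x y = levelSum n y x := by
  induction n generalizing x y with
  | zero => rfl
  | succ n ih => rw [levelSum, levelSum, bitSum_comm, ih]

theorem min_log_two_mem {x : ℝ} (hx : 0 ≤ x) : min x (Real.log 2) ∈ Icc 0 (Real.log 2) :=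
  ⟨le_min hx log_two_pos.le, min_le_right _ _⟩

theorem max_sub_log_two_mem {n : ℕ} {x : ℝ} (hx : x ∈ Icc 0 ((n + 1 : ℕ) * Real.log 2)) :
    max (x - Real.log 2) 0 ∈ Icc 0 (n * Real.log 2) := by
  refine ⟨le_max_right _ _, max_le ?_ (by have := log_two_pos; positivity)⟩
  have := hx.2
  push_cast at this
  linarith

theorem min_add_max_sub (x L : ℝ) : min x L + max (x - L) 0 = x := by
  rcases le_total x L with h | h
  · rw [min_eq_left h, max_eq_right (sub_nonpos.2 h), add_zero]
  · rw [min_eq_right h, max_eq_left (sub_nonneg.2 h)]; ring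

theorem levelSum_mono_left (n : ℕ) {x x' y : ℝ} (hx : 0 ≤ x) (hy : 0 ≤ y) (h : x ≤ x') :
    levelSum n x y ≤ levelSum n x' y := by
  induction n generalizing x x' y with
  | zero => exact le_rfl
  | succ n ih =>
    refine add_le_add (bitSum_mono_left (min_log_two_mem hx) (min_log_two_mem (hx.trans h))
      (min_log_two_mem hy) (min_le_min_right _ h)) (ih (le_max_right _ _) (le_max_right _ _) ?_)
    exact max_le_max_right _ (by linarith)

theorem levelSum_mono_right (n : ℕ) {x y y' : ℝ} (hx : 0 ≤ x) (hy : 0 ≤ y) (h : y ≤ y') :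
    levelSum n x y ≤ levelSum n x y' := by
  rw [levelSum_comm n x, levelSum_comm n x]; exact levelSum_mono_left n hy hx h

theorem levelSum_mem (n : ℕ) {x y : ℝ} (hx : 0 ≤ x) (hy : 0 ≤ y) :
    levelSum n x y ∈ Icc 0 (n * Real.log 2) := by
  induction n generalizing x y with
  | zero => simp [levelSum]
  | succ n ih =>
    have h1 := bitSum_mem (min_log_two_mem hx) (min_log_two_mem hy)
    have h2 := ih (le_max_right (x - Real.log 2) 0) (le_max_right (y - Real.log 2) 0)
    rw [levelSum]
    constructor
    · exact add_nonneg h1.1 h2.1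
    · push_cast
      linarith [h1.2, h2.2]

theorem levelSum_zero_right (n : ℕ) {x : ℝ} (hx : x ∈ Icc 0 (n * Real.log 2)) :
    levelSum n x 0 = x := by
  induction n generalizing x with
  | zero =>
    rw [Nat.cast_zero, zero_mul, Icc_self] at hx
    exact (mem_singleton_iff.1 hx).symm
  | succ n ih =>
    rw [levelSum, min_eq_left log_two_pos.le, bitSum_zero_right (min_log_two_mem hx.1),
      max_eq_right (by linarith [log_two_pos] : 0 - Real.log 2 ≤ 0),
      ih (max_sub_log_two_mem hx), min_add_max_sub]

theorem levelSum_zero_left (n : ℕ) {x : ℝ} (hx : x ∈ Icc 0 (n * Real.log 2)) :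
    levelSum n 0 x = x := by
  rw [levelSum_comm, levelSum_zero_right n hx]

theorem convexOn_levelSum (n : ℕ) {y : ℝ} (hy : y ∈ Icc 0 (n * Real.log 2)) :
    ConvexOn ℝ (Icc 0 (n * Real.log 2)) fun x => levelSum n x y := by
  induction n generalizing y with
  | zero => exact convexOn_const 0 (convex_Icc _ _)
  | succ n ih =>
    have hconv : Convex ℝ (Icc 0 ((n + 1 : ℕ) * Real.log 2)) := convex_Icc _ _
    have hid : ConvexOn ℝ (Icc 0 ((n + 1 : ℕ) * Real.log 2)) fun x : ℝ => x := convexOn_id hconv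
    rcases le_total y (Real.log 2) with h | h
    · -- `x ↦ bitSum x y - x` decreases, so that it stays convex after composition with `min · L`
      have h1 : ConvexOn ℝ (Icc 0 ((n + 1 : ℕ) * Real.log 2))
          fun x => bitSum (min x (Real.log 2)) y - min x (Real.log 2) := by
        refine convexOn_comp_of_antitoneOn (f := fun x => min x (Real.log 2))
          (convexOn_bitSum_sub ⟨hy.1, h⟩) (antitoneOn_bitSum_sub ⟨hy.1, h⟩) ?_
          fun x hx => min_log_two_mem hx.1
        exact ConcaveOn.inf (concaveOn_id hconv) (concaveOn_const _ hconv)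
      refine (h1.add hid).congr fun x hx => ?_
      simp only [Pi.add_apply]
      rw [levelSum, min_eq_left h, max_eq_right (sub_nonpos.2 h),
        levelSum_zero_right n (max_sub_log_two_mem hx)]
      linarith [min_add_max_sub x (Real.log 2)]
    · have hy' := max_sub_log_two_mem hy
      have h1 : ConvexOn ℝ (Icc 0 ((n + 1 : ℕ) * Real.log 2))
          fun x => levelSum n (max (x - Real.log 2) 0) (max (y - Real.log 2) 0) := by
        refine convexOn_comp_of_monotoneOn (f := fun x => max (x - Real.log 2) 0) (ih hy')
          (fun x hx x' _ hxx => levelSum_mono_left n hx.1 hy'.1 hxx) ?_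
          fun x hx => max_sub_log_two_mem hx
        exact ConvexOn.sup (hid.sub (concaveOn_const _ hconv)) (convexOn_const _ hconv)
      refine (h1.add (convexOn_const (Real.log 2) hconv)).congr fun x hx => ?_
      simp only [Pi.add_apply]
      rw [levelSum, min_eq_right h, bitSum_log_two_right, add_comm]

theorem min_add_eq {x u L : ℝ} (hu : 0 ≤ u) :
    min (x + u) L = min (min x L + u) L := by
  rcases le_total x L with h | h
  · rw [min_eq_left h]
  · rw [min_eq_right h, min_eq_right (by linarith), min_eq_right (by linarith)]

theorem max_add_sub_eq {x u L : ℝ} (hu : 0 ≤ u) :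
    max (x + u - L) 0 = max (x - L) 0 + max (min x L + u - L) 0 := by
  rcases le_total x L with h | h
  · rw [min_eq_left h, max_eq_right (sub_nonpos.2 h), zero_add]
  · rw [min_eq_right h, max_eq_left (sub_nonneg.2 h), max_eq_left (by linarith),
      max_eq_left (by linarith)]
    ring

/-- Adding one more bit to each variable: filling the bits greedily is at least as good. -/
theorem levelSum_add_le (n : ℕ) {x y u v : ℝ} (hx : x ∈ Icc 0 (n * Real.log 2))
    (hy : y ∈ Icc 0 (n * Real.log 2)) (hu : u ∈ Icc 0 (Real.log 2))
    (hv : v ∈ Icc 0 (Real.log 2)) :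
    levelSum (n + 1) (x + u) (y + v) ≤ levelSum n x y + bitSum u v := by
  induction n generalizing x y u v with
  | zero =>
    simp only [Nat.cast_zero, zero_mul, Icc_self, mem_singleton_iff] at hx hy
    subst hx hy
    simp [levelSum, min_eq_left hu.2, min_eq_left hv.2]
  | succ n ih =>
    have hx1 := min_log_two_mem hx.1
    have hy1 := min_log_two_mem hy.1
    have hr : ∀ {a w : ℝ}, a ∈ Icc 0 (Real.log 2) → w ∈ Icc 0 (Real.log 2) →
        max (a + w - Real.log 2) 0 ∈ Icc 0 (Real.log 2) := fun ha hw =>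
      ⟨le_max_right _ _, max_le (by linarith [ha.2, hw.2]) log_two_pos.le⟩
    have h1 := ih (max_sub_log_two_mem hx) (max_sub_log_two_mem hy) (hr hx1 hu) (hr hy1 hv)
    have h2 := bitSumSplit_le hx1 hu hy1 hv
    rw [levelSum_succ (n + 1), levelSum_succ n x, min_add_eq hu.1, min_add_eq hv.1,
      max_add_sub_eq hu.1, max_add_sub_eq hv.1]
    rw [bitSumSplit] at h2
    linarith

/-! ### The entropy of a pair of weights -/

/-- The entropy, times the total mass, of the two-point distribution proportional to `(a, b)`. -/
noncomputable def pairEnt (a b : ℝ) : ℝ :=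
  Real.negMulLog a + Real.negMulLog b - Real.negMulLog (a + b)

theorem pairEnt_mul (c a b : ℝ) : pairEnt (c * a) (c * b) = c * pairEnt a b := by
  unfold pairEnt
  rw [← mul_add, Real.negMulLog_mul, Real.negMulLog_mul, Real.negMulLog_mul]
  ring

theorem pairEnt_eq_binEntropy {a b : ℝ} (ha : 0 ≤ a) (hb : 0 ≤ b) :
    pairEnt a b = (a + b) * Real.binEntropy (b / (a + b)) := by
  rcases eq_or_lt_of_le (add_nonneg ha hb) with h | h
  · have h1 : a = 0 := by linarith
    have h2 : b = 0 := by linarith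
    simp [pairEnt, h1, h2]
  · have e : pairEnt ((a + b) * (1 - b / (a + b))) ((a + b) * (b / (a + b))) = pairEnt a b := by
      congr 1 <;> field_simp
      ring
    rw [← e, pairEnt_mul, pairEnt, Real.binEntropy_eq_negMulLog_add_negMulLog_one_sub]
    simp
    left; ring

theorem pairEnt_eq {a b : ℝ} (ha : 0 ≤ a) (hb : 0 ≤ b) :
    pairEnt a b = (a + b) * biasEntropy ((a - b) / (a + b)) := by
  rw [pairEnt_eq_binEntropy ha hb, biasEntropy]
  rcases eq_or_lt_of_le (add_nonneg ha hb) with h | h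
  · rw [← h, zero_mul, zero_mul]
  · congr 2
    field_simp
    ring

theorem sub_div_add_mem {a b : ℝ} (ha : 0 ≤ a) (hb : 0 ≤ b) :
    (a - b) / (a + b) ∈ Icc (-1 : ℝ) 1 := by
  rcases eq_or_lt_of_le (add_nonneg ha hb) with h | h
  · rw [← h, div_zero]; norm_num
  · constructor
    · rw [le_div_iff₀ h]; linarith
    · rw [div_le_one h]; linarith

/-- The pair entropy of a cyclic convolution of length two. -/
theorem pairEnt_conv {a b c d : ℝ} (ha : 0 ≤ a) (hb : 0 ≤ b) (hc : 0 ≤ c) (hd : 0 ≤ d) :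
    pairEnt (a * c + b * d) (a * d + b * c) = (a + b) * (c + d) *
      bitSum (biasEntropy ((a - b) / (a + b))) (biasEntropy ((c - d) / (c + d))) := by
  rw [pairEnt_eq (by positivity) (by positivity), bitSum_biasEntropy (sub_div_add_mem ha hb)
    (sub_div_add_mem hc hd), div_mul_div_comm]
  congr 2
  · ring
  · congr 1 <;> ring

/-- Superadditivity, which is Jensen's inequality for the binary entropy. -/
theorem sum_pairEnt_le {ι : Type*} (s : Finset ι) (a b : ι → ℝ) (ha : ∀ i ∈ s, 0 ≤ a i)
    (hb : ∀ i ∈ s, 0 ≤ b i) :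
    ∑ i ∈ s, pairEnt (a i) (b i) ≤ pairEnt (∑ i ∈ s, a i) (∑ i ∈ s, b i) := by
  have hA := Finset.sum_nonneg ha
  have hB := Finset.sum_nonneg hb
  set A := ∑ i ∈ s, a i with hAdef
  set B := ∑ i ∈ s, b i with hBdef
  rcases eq_or_lt_of_le (add_nonneg hA hB) with h | h
  · have h1 : A = 0 := by linarith
    have h2 : B = 0 := by linarith
    rw [h1, h2]
    refine (Finset.sum_eq_zero fun i hi => ?_).le.trans (by simp [pairEnt])
    rw [(Finset.sum_eq_zero_iff_of_nonneg ha).1 h1 i hi,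
      (Finset.sum_eq_zero_iff_of_nonneg hb).1 h2 i hi]
    simp [pairEnt]
  · have hw : ∑ i ∈ s, (a i + b i) / (A + B) = 1 := by
      rw [← Finset.sum_div, Finset.sum_add_distrib, div_self h.ne']
    have hJ := Real.strictConcave_binEntropy.concaveOn.le_map_sum (t := s)
      (w := fun i => (a i + b i) / (A + B)) (p := fun i => b i / (a i + b i))
      (fun i hi => div_nonneg (add_nonneg (ha i hi) (hb i hi)) h.le) hw
      (fun i hi => ⟨div_nonneg (hb i hi) (add_nonneg (ha i hi) (hb i hi)),
        div_le_one_of_le₀ (by linarith [ha i hi]) (add_nonneg (ha i hi) (hb i hi))⟩)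
    have e : ∑ i ∈ s, (a i + b i) / (A + B) * (b i / (a i + b i)) = B / (A + B) := by
      rw [hBdef, Finset.sum_div]
      refine Finset.sum_congr rfl fun i hi => ?_
      rcases eq_or_lt_of_le (add_nonneg (ha i hi) (hb i hi)) with h0 | h0
      · have : b i = 0 := by linarith [ha i hi, hb i hi]
        simp [this]
      · field_simp
    simp only [smul_eq_mul] at hJ
    rw [e] at hJ
    rw [pairEnt_eq_binEntropy hA hB]
    calc ∑ i ∈ s, pairEnt (a i) (b i)
        = (A + B) * ∑ i ∈ s, (a i + b i) / (A + B) * Real.binEntropy (b i / (a i + b i)) := by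
          rw [Finset.mul_sum]
          refine Finset.sum_congr rfl fun i hi => ?_
          rw [pairEnt_eq_binEntropy (ha i hi) (hb i hi)]
          field_simp
      _ ≤ _ := mul_le_mul_of_nonneg_left hJ h.le

/-! ### Probability mass functions and their convolution -/

/-- The entropy of a real valued mass function. -/
noncomputable def ent {G : Type*} [Fintype G] (p : G → ℝ) : ℝ := ∑ g, Real.negMulLog (p g)

/-- A real valued probability mass function on a finite type. -/
structure IsPmf {G : Type*} [Fintype G] (p : G → ℝ) : Prop where
  nonneg : ∀ g, 0 ≤ p g
  sum_eq : ∑ g, p g = 1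

/-- The convolution of two functions on a finite group, which is the mass function of the sum of
independent variables. -/
noncomputable def conv {G : Type*} [AddCommGroup G] [Fintype G] (p q : G → ℝ) (g : G) : ℝ :=
  ∑ h, p h * q (g - h)

section conv

variable {G : Type*} [AddCommGroup G] [Fintype G]

theorem conv_comm (p q : G → ℝ) : conv p q = conv q p := by
  funext g
  unfold conv
  rw [← (Equiv.subLeft g).sum_comp]
  refine Finset.sum_congr rfl fun h _ => ?_
  rw [Equiv.subLeft_apply, sub_sub_cancel, mul_comm]

theorem sum_sum_sub (F : G → G → ℝ) : ∑ g, ∑ h, F h (g - h) = ∑ h, ∑ k, F h k := by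
  rw [Finset.sum_comm]
  exact Finset.sum_congr rfl fun h _ => (Equiv.subRight h).sum_comp (F h)

theorem IsPmf.conv {p q : G → ℝ} (hp : IsPmf p) (hq : IsPmf q) : IsPmf (conv p q) where
  nonneg g := Finset.sum_nonneg fun h _ => mul_nonneg (hp.nonneg h) (hq.nonneg _)
  sum_eq := by
    unfold EntropySum.conv
    rw [sum_sum_sub fun h k => p h * q k]
    simp_rw [← Finset.mul_sum, hq.sum_eq, mul_one, hp.sum_eq]

end conv

/-! ### Quotients by a subgroup of order two -/

/-- A surjective homomorphism whose kernel is `{0, τ}` with `τ ≠ 0`. -/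
structure IsTwoCover {G Q : Type*} [AddCommGroup G] [AddCommGroup Q] (π : G →+ Q) (τ : G) :
    Prop where
  surj : Function.Surjective π
  ne_zero : τ ≠ 0
  ker : ∀ g, π g = 0 ↔ g = 0 ∨ g = τ

theorem exists_isTwoCover {G : Type u} [AddCommGroup G] [Fintype G] {n : ℕ}
    (hG : Fintype.card G = 2 ^ (n + 1)) :
    ∃ (Q : Type u) (_ : AddCommGroup Q) (_ : Fintype Q) (π : G →+ Q) (τ : G),
      IsTwoCover π τ ∧ Fintype.card Q = 2 ^ n := by
  classical
  have : Fact (Nat.Prime 2) := ⟨Nat.prime_two⟩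
  obtain ⟨τ, hτ⟩ := exists_prime_addOrderOf_dvd_card (G := G) 2
    (by rw [hG, pow_succ]; exact dvd_mul_left _ _)
  have h2 : 2 • τ = 0 := by rw [← hτ]; exact addOrderOf_nsmul_eq_zero τ
  have h0 : τ ≠ 0 := by
    rintro rfl
    simp at hτ
  refine ⟨G ⧸ AddSubgroup.zmultiples τ, inferInstance, inferInstance,
    QuotientAddGroup.mk' _, τ, ⟨QuotientAddGroup.mk'_surjective _, h0, fun g => ?_⟩, ?_⟩
  · rw [QuotientAddGroup.mk'_apply, QuotientAddGroup.eq_zero_iff,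
      AddSubgroup.mem_zmultiples_iff]
    constructor
    · rintro ⟨k, rfl⟩
      have h2' : (2 : ℤ) • τ = 0 := by exact_mod_cast h2
      rcases Int.even_or_odd' k with ⟨m, rfl | rfl⟩
      · left; rw [mul_comm, mul_smul, h2', smul_zero]
      · right; rw [add_smul, mul_comm, mul_smul, h2', smul_zero, zero_add, one_smul]
    · rintro (rfl | rfl)
      · exact ⟨0, zero_smul _ _⟩
      · exact ⟨1, one_smul _ _⟩
  · have := AddSubgroup.card_eq_card_quotient_mul_card_addSubgroup (AddSubgroup.zmultiples τ)
    rw [Nat.card_zmultiples, hτ, Nat.card_eq_fintype_card, hG, pow_succ] at this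
    rw [← Nat.card_eq_fintype_card]
    omega

/-- The mass function of the image of a variable under `π`. -/
noncomputable def push {G Q : Type*} [Fintype G] (π : G → Q) (p : G → ℝ) (r : Q) : ℝ :=
  open Classical in ∑ g, if π g = r then p g else 0

/-- The mean entropy of the conditional distributions on the cosets of `{0, τ}`. Summation over
all group elements counts each coset twice. -/
noncomputable def fibreEnt {G : Type*} [AddCommGroup G] [Fintype G] (τ : G) (p : G → ℝ) : ℝ :=
  (∑ g, pairEnt (p g) (p (g + τ))) / 2

theorem IsTwoCover.add_self {G Q : Type*} [AddCommGroup G] [AddCommGroup Q] {π : G →+ Q} {τ : G}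
    (hπ : IsTwoCover π τ) : τ + τ = 0 := by
  have h1 : π τ = 0 := (hπ.ker τ).2 (Or.inr rfl)
  rcases (hπ.ker (τ + τ)).1 (by rw [map_add, h1, add_zero]) with h | h
  · exact h
  · exact (hπ.ne_zero (by simpa using h)).elim

theorem push_apply {G Q : Type*} [AddCommGroup G] [AddCommGroup Q] [Fintype G] {π : G →+ Q}
    {τ : G} (hπ : IsTwoCover π τ) (p : G → ℝ) (g : G) :
    push π p (π g) = p g + p (g + τ) := by
  classical
  have hiff : ∀ h, π h = π g ↔ h = g ∨ h = g + τ := by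
    intro h
    rw [← sub_eq_zero, ← map_sub, hπ.ker, sub_eq_zero, sub_eq_iff_eq_add']
  have hne : g ≠ g + τ := fun h => hπ.ne_zero (by simpa using h.symm)
  have : (Finset.univ.filter fun h => π h = π g) = {g, g + τ} := by
    ext h; simp [hiff]
  rw [push, ← Finset.sum_pair hne, ← this, Finset.sum_filter]

theorem sum_push_mul {G Q : Type*} [Fintype G] [Fintype Q] (π : G → Q) (p : G → ℝ) (φ : Q → ℝ) :
    ∑ r, push π p r * φ r = ∑ g, p g * φ (π g) := by
  classical
  simp only [push, Finset.sum_mul]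
  rw [Finset.sum_comm]
  refine Finset.sum_congr rfl fun g _ => ?_
  simp

theorem IsPmf.push {G Q : Type*} [Fintype G] [Fintype Q] {p : G → ℝ} (hp : IsPmf p) (π : G → Q) :
    IsPmf (push π p) where
  nonneg r := Finset.sum_nonneg fun g _ => by
    split_ifs
    exacts [hp.nonneg g, le_rfl]
  sum_eq := by
    have := sum_push_mul π p fun _ => 1
    simp only [mul_one] at this
    rw [this, hp.sum_eq]

section TwoCover

variable {G Q : Type*} [AddCommGroup G] [AddCommGroup Q] [Fintype G] [Fintype Q] {π : G →+ Q}
  {τ : G}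

theorem IsTwoCover.sum_comp (hπ : IsTwoCover π τ) (φ : Q → ℝ) : ∑ g, φ (π g) = 2 * ∑ r, φ r := by
  have h := sum_push_mul π (fun _ => (1 : ℝ)) φ
  simp only [one_mul] at h
  rw [← h, Finset.mul_sum]
  refine Finset.sum_congr rfl fun r _ => ?_
  obtain ⟨g, rfl⟩ := hπ.surj r
  rw [push_apply hπ]; ring

theorem push_conv (π : G →+ Q) (p q : G → ℝ) :
    push π (conv p q) = conv (push π p) (push π q) := by
  classical
  funext r
  rw [conv, sum_push_mul π p fun s => push π q (r - s)]
  have h1 : push π (conv p q) r =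
      ∑ g, ∑ h, (fun h k => if π (h + k) = r then p h * q k else 0) h (g - h) := by
    refine Finset.sum_congr rfl fun g _ => ?_
    simp only [add_sub_cancel]
    split_ifs
    · rfl
    · simp
  rw [h1, sum_sum_sub fun h k => if π (h + k) = r then p h * q k else 0]
  refine Finset.sum_congr rfl fun h _ => ?_
  rw [push, Finset.mul_sum]
  refine Finset.sum_congr rfl fun k _ => ?_
  rw [map_add, mul_ite, mul_zero]
  congr 1
  rw [eq_sub_iff_add_eq, add_comm]

/-- The chain rule for the entropy. -/
theorem ent_eq_push_add (hπ : IsTwoCover π τ) (p : G → ℝ) :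
    ent p = ent (push π p) + fibreEnt τ p := by
  have h1 : ∑ g, pairEnt (p g) (p (g + τ)) =
      ent p + ent p - ∑ g, Real.negMulLog (push π p (π g)) := by
    simp only [pairEnt, Finset.sum_sub_distrib, Finset.sum_add_distrib, ← push_apply hπ]
    congr 2
    exact Equiv.sum_comp (Equiv.addRight τ) fun g => Real.negMulLog (p g)
  rw [hπ.sum_comp fun r => Real.negMulLog (push π p r)] at h1
  rw [fibreEnt, h1, ent, ent]
  ring

theorem IsPmf.sum_weight {p : G → ℝ} (hp : IsPmf p) (τ : G) :
    ∑ g, (p g + p (g + τ)) / 2 = 1 := by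
  have h : ∑ g, p (g + τ) = ∑ g, p g := Equiv.sum_comp (Equiv.addRight τ) p
  rw [← Finset.sum_div, Finset.sum_add_distrib, h, hp.sum_eq]
  norm_num

theorem fibreEnt_eq {p : G → ℝ} (hp : IsPmf p) (τ : G) :
    fibreEnt τ p = ∑ g, (p g + p (g + τ)) / 2 *
      biasEntropy ((p g - p (g + τ)) / (p g + p (g + τ))) := by
  rw [fibreEnt, Finset.sum_div]
  refine Finset.sum_congr rfl fun g _ => ?_
  rw [pairEnt_eq (hp.nonneg _) (hp.nonneg _)]
  ring

theorem fibreEnt_mem {p : G → ℝ} (hp : IsPmf p) (τ : G) :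
    fibreEnt τ p ∈ Icc 0 (Real.log 2) := by
  rw [fibreEnt_eq hp]
  refine (convex_Icc (0 : ℝ) (Real.log 2)).sum_mem (fun g _ => ?_) (hp.sum_weight τ)
    fun g _ => biasEntropy_mem (sub_div_add_mem (hp.nonneg _) (hp.nonneg _))
  have := hp.nonneg g
  have := hp.nonneg (g + τ)
  positivity

end TwoCover

/-- The conditional entropy of a sum, given its image in the quotient. By superadditivity of
`pairEnt` it decreases if one conditions on both images; Jensen's inequality for `bitSum` in each
variable does the rest. -/
theorem bitSum_fibreEnt_le {G Q : Type*} [AddCommGroup G] [AddCommGroup Q] [Fintype G]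
    {π : G →+ Q} {τ : G} (hπ : IsTwoCover π τ) {p q : G → ℝ} (hp : IsPmf p) (hq : IsPmf q) :
    bitSum (fibreEnt τ p) (fibreEnt τ q) ≤ fibreEnt τ (conv p q) := by
  have hττ := hπ.add_self
  set c₁ : G → G → ℝ := fun h k => p h * q k + p (h + τ) * q (k + τ) with hc₁
  set c₂ : G → G → ℝ := fun h k => p h * q (k + τ) + p (h + τ) * q k with hc₂
  have e₁ : ∀ g, ∑ h, c₁ h (g - h) = 2 * conv p q g := by
    intro g
    have : ∑ h, p (h + τ) * q (g - h + τ) = conv p q g := by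
      rw [conv, ← Equiv.sum_comp (Equiv.addRight τ)]
      refine Finset.sum_congr rfl fun h _ => ?_
      simp only [Equiv.coe_addRight]
      have : g - (h + τ) + τ = g - h := by abel
      rw [this, add_assoc, hττ, add_zero]
    simp only [hc₁, Finset.sum_add_distrib, this]
    rw [← conv, two_mul]
  have e₂ : ∀ g, ∑ h, c₂ h (g - h) = 2 * conv p q (g + τ) := by
    intro g
    have h1 : ∑ h, p h * q (g - h + τ) = conv p q (g + τ) := by
      refine Finset.sum_congr rfl fun h _ => ?_
      rw [sub_add_eq_add_sub]
    have h2 : ∑ h, p (h + τ) * q (g - h) = conv p q (g + τ) := by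
      rw [conv, ← Equiv.sum_comp (Equiv.addRight τ)]
      refine Finset.sum_congr rfl fun h _ => ?_
      have : g + τ - h = g - (h + τ) + (τ + τ) := by abel
      simp only [Equiv.coe_addRight]
      rw [this, add_assoc, hττ, add_zero, add_zero]
    simp only [hc₂, Finset.sum_add_distrib, h1, h2]
    rw [two_mul]
  set ω : (G → ℝ) → G → ℝ := fun p g => (p g + p (g + τ)) / 2 with hω
  set β : (G → ℝ) → G → ℝ := fun p g => biasEntropy ((p g - p (g + τ)) / (p g + p (g + τ))) with hβ
  have hωn : ∀ {p : G → ℝ}, IsPmf p → ∀ g, 0 ≤ ω p g := by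
    intro p hp g
    have := hp.nonneg g
    have := hp.nonneg (g + τ)
    simp only [hω]; positivity
  have hβm : ∀ {p : G → ℝ}, IsPmf p → ∀ g, β p g ∈ Icc 0 (Real.log 2) := fun hp g =>
    biasEntropy_mem (sub_div_add_mem (hp.nonneg _) (hp.nonneg _))
  have hc₁n : ∀ h k, 0 ≤ c₁ h k := fun h k =>
    add_nonneg (mul_nonneg (hp.nonneg _) (hq.nonneg _)) (mul_nonneg (hp.nonneg _) (hq.nonneg _))
  have hc₂n : ∀ h k, 0 ≤ c₂ h k := fun h k =>
    add_nonneg (mul_nonneg (hp.nonneg _) (hq.nonneg _)) (mul_nonneg (hp.nonneg _) (hq.nonneg _))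
  have hpair : ∀ h k, pairEnt (c₁ h k) (c₂ h k) = 4 * (ω p h * (ω q k * bitSum (β p h) (β q k))) := by
    intro h k
    rw [hc₁, hc₂, pairEnt_conv (hp.nonneg _) (hp.nonneg _) (hq.nonneg _) (hq.nonneg _)]
    simp only [hω, hβ]
    ring
  calc bitSum (fibreEnt τ p) (fibreEnt τ q)
      = bitSum (∑ h, ω p h * β p h) (∑ k, ω q k * β q k) := by
        rw [fibreEnt_eq hp, fibreEnt_eq hq]
    _ ≤ ∑ h, ω p h * bitSum (β p h) (∑ k, ω q k * β q k) := by
        have hmem := fibreEnt_mem hq τ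
        rw [fibreEnt_eq hq] at hmem
        exact (convexOn_bitSum hmem).map_sum_le (fun g _ => hωn hp g) (hp.sum_weight τ)
          fun g _ => hβm hp g
    _ ≤ ∑ h, ω p h * ∑ k, ω q k * bitSum (β p h) (β q k) := by
        refine Finset.sum_le_sum fun h _ => mul_le_mul_of_nonneg_left ?_ (hωn hp h)
        simp only [bitSum_comm (β p h)]
        exact (convexOn_bitSum (hβm hp h)).map_sum_le (fun g _ => hωn hq g) (hq.sum_weight τ)
          fun g _ => hβm hq g
    _ = (∑ h, ∑ k, pairEnt (c₁ h k) (c₂ h k)) / 4 := by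
        simp only [hpair, ← Finset.mul_sum]
        ring
    _ = (∑ g, ∑ h, pairEnt (c₁ h (g - h)) (c₂ h (g - h))) / 4 := by
        rw [sum_sum_sub fun h k => pairEnt (c₁ h k) (c₂ h k)]
    _ ≤ (∑ g, 2 * pairEnt (conv p q g) (conv p q (g + τ))) / 4 := by
        gcongr with g
        refine (sum_pairEnt_le _ _ _ (fun h _ => hc₁n _ _) fun h _ => hc₂n _ _).trans ?_
        rw [e₁, e₂, pairEnt_mul]
    _ = fibreEnt τ (conv p q) := by
        rw [fibreEnt, ← Finset.mul_sum]; ring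

/-! ### The lower bound for two summands -/

theorem isPmf_eq_one {G : Type*} [AddCommGroup G] [Fintype G] (hG : Fintype.card G = 2 ^ 0)
    {p : G → ℝ} (hp : IsPmf p) : p = fun _ => 1 := by
  have hsub := Fintype.card_le_one_iff_subsingleton.1 hG.le
  have : Unique G := uniqueOfSubsingleton 0
  funext g
  have := hp.sum_eq
  rw [Fintype.sum_unique] at this
  rw [Subsingleton.elim g default, this]

theorem ent_mem (n : ℕ) {G : Type u} [AddCommGroup G] [Fintype G] (hG : Fintype.card G = 2 ^ n)
    {p : G → ℝ} (hp : IsPmf p) : ent p ∈ Icc 0 (n * Real.log 2) := by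
  induction n generalizing G with
  | zero => simp [isPmf_eq_one hG hp, ent]
  | succ n ih =>
    obtain ⟨Q, _, _, π, τ, hπ, hQ⟩ := exists_isTwoCover hG
    have h1 := ih hQ (hp.push π)
    have h2 := fibreEnt_mem hp τ
    rw [ent_eq_push_add hπ]
    push_cast
    constructor
    · linarith [h1.1, h2.1]
    · linarith [h1.2, h2.2]

theorem levelSum_le_ent_conv (n : ℕ) {G : Type u} [AddCommGroup G] [Fintype G]
    (hG : Fintype.card G = 2 ^ n) {p q : G → ℝ} (hp : IsPmf p) (hq : IsPmf q) :
    levelSum n (ent p) (ent q) ≤ ent (conv p q) := by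
  induction n generalizing G with
  | zero => exact (ent_mem 0 hG (hp.conv hq)).1
  | succ n ih =>
    obtain ⟨Q, _, _, π, τ, hπ, hQ⟩ := exists_isTwoCover hG
    rw [ent_eq_push_add hπ p, ent_eq_push_add hπ q, ent_eq_push_add hπ (conv p q), push_conv]
    exact (levelSum_add_le n (ent_mem n hQ (hp.push π)) (ent_mem n hQ (hq.push π))
      (fibreEnt_mem hp τ) (fibreEnt_mem hq τ)).trans
      (add_le_add (ih hQ (hp.push π) (hq.push π)) (bitSum_fibreEnt_le hπ hp hq))

/-! ### Extremal distributions -/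

/-- The mass function on `{0, τ}` with bias `r`. -/
noncomputable def twoPoint {G : Type*} [Zero G] (τ : G) (r : ℝ) (g : G) : ℝ :=
  open Classical in (1 + r) / 2 * (if g = 0 then 1 else 0) + (1 - r) / 2 * (if g = τ then 1 else 0)

/-- The mass function of a variable with image distributed as `P` in the quotient and uniform
conditional distributions on the cosets of `{0, τ}`. -/
noncomputable def liftPmf {G Q : Type*} (π : G → Q) (P : Q → ℝ) (g : G) : ℝ := P (π g) / 2

theorem twoPoint_zero_arg {G : Type*} [Zero G] {τ : G} (hτ : τ ≠ 0) (r : ℝ) :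
    twoPoint τ r 0 = (1 + r) / 2 := by
  simp [twoPoint, hτ.symm]

theorem twoPoint_self {G : Type*} [Zero G] {τ : G} (hτ : τ ≠ 0) (r : ℝ) :
    twoPoint τ r τ = (1 - r) / 2 := by
  simp [twoPoint, hτ]

theorem twoPoint_of_ne {G : Type*} [Zero G] {τ g : G} (h0 : g ≠ 0) (hτ : g ≠ τ) (r : ℝ) :
    twoPoint τ r g = 0 := by
  simp [twoPoint, hτ, h0]

theorem liftPmf_indicator {G Q : Type*} [AddCommGroup G] [AddCommGroup Q] {π : G →+ Q} {τ : G}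
    (hπ : IsTwoCover π τ) : liftPmf π (indicator {0} 1) = twoPoint τ 0 := by
  classical
  funext g
  simp only [liftPmf, twoPoint, indicator_apply, mem_singleton_iff, Pi.one_apply, hπ.ker g]
  by_cases h0 : g = 0
  · simp [h0, hπ.ne_zero.symm]
  · simp only [h0, false_or, if_false]
    split_ifs <;> norm_num

theorem sum_twoPoint_mul {G : Type*} [AddCommGroup G] [Fintype G] (τ : G) (r : ℝ) (φ : G → ℝ) :
    ∑ g, twoPoint τ r g * φ g = (1 + r) / 2 * φ 0 + (1 - r) / 2 * φ τ := by
  classical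
  simp only [twoPoint, add_mul, mul_assoc, Finset.sum_add_distrib, ← Finset.mul_sum, ite_mul,
    one_mul, zero_mul, Finset.sum_ite_eq', Finset.mem_univ, if_true]

theorem conv_twoPoint_twoPoint {G Q : Type*} [AddCommGroup G] [AddCommGroup Q] [Fintype G]
    {π : G →+ Q} {τ : G} (hπ : IsTwoCover π τ) (r s : ℝ) :
    conv (twoPoint τ r) (twoPoint τ s) = twoPoint τ (r * s) := by
  funext g
  have hτ := hπ.ne_zero
  have hneg : -τ = τ := neg_eq_of_add_eq_zero_left hπ.add_self
  rw [conv, sum_twoPoint_mul τ r fun h => twoPoint τ s (g - h), sub_zero]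
  by_cases h0 : g = 0
  · rw [h0, zero_sub, hneg, twoPoint_zero_arg hτ, twoPoint_self hτ, twoPoint_zero_arg hτ]
    ring
  by_cases h1 : g = τ
  · rw [h1, sub_self, twoPoint_zero_arg hτ, twoPoint_self hτ, twoPoint_self hτ]
    ring
  · rw [twoPoint_of_ne h0 h1, twoPoint_of_ne h0 h1, twoPoint_of_ne (sub_ne_zero.2 h1)
      fun h => h0 (by rw [sub_eq_iff_eq_add.1 h, hπ.add_self]), mul_zero, mul_zero, add_zero]

theorem conv_twoPoint_liftPmf {G Q : Type*} [AddCommGroup G] [AddCommGroup Q] [Fintype G]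
    {π : G →+ Q} {τ : G} (hπ : IsTwoCover π τ) (r : ℝ) (P : Q → ℝ) :
    conv (twoPoint τ r) (liftPmf π P) = liftPmf π P := by
  funext g
  have hτ : π τ = 0 := (hπ.ker τ).2 (Or.inr rfl)
  rw [conv, sum_twoPoint_mul τ r fun h => liftPmf π P (g - h)]
  simp only [liftPmf, map_sub, hτ, sub_zero]
  ring

section Extremal

variable {G Q : Type*} [AddCommGroup G] [AddCommGroup Q] [Fintype G] [Fintype Q] {π : G →+ Q}
  {τ : G}

theorem isPmf_twoPoint {r : ℝ} (hr : r ∈ Icc (0 : ℝ) 1) : IsPmf (twoPoint τ r) where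
  nonneg g := by
    have h1 : 0 ≤ (1 + r) / 2 := by linarith [hr.1]
    have h2 : 0 ≤ (1 - r) / 2 := by linarith [hr.2]
    unfold twoPoint
    positivity
  sum_eq := by
    have := sum_twoPoint_mul τ r fun _ => 1
    simp only [mul_one] at this
    rw [this]; ring

theorem ent_twoPoint (hτ : τ ≠ 0) (r : ℝ) : ent (twoPoint τ r) = biasEntropy r := by
  classical
  have : ent (twoPoint τ r) = ∑ g ∈ {0, τ}, Real.negMulLog (twoPoint τ r g) := by
    refine (Finset.sum_subset (Finset.subset_univ _) fun g _ hg => ?_).symm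
    simp only [Finset.mem_insert, Finset.mem_singleton, not_or] at hg
    rw [twoPoint_of_ne hg.1 hg.2, Real.negMulLog_zero]
  rw [this, Finset.sum_pair hτ.symm, twoPoint_zero_arg hτ, twoPoint_self hτ, biasEntropy,
    Real.binEntropy_eq_negMulLog_add_negMulLog_one_sub, add_comm]
  congr 2
  ring

theorem isPmf_liftPmf (hπ : IsTwoCover π τ) {P : Q → ℝ} (hP : IsPmf P) : IsPmf (liftPmf π P) where
  nonneg g := div_nonneg (hP.nonneg _) (by norm_num)
  sum_eq := by
    unfold liftPmf
    rw [hπ.sum_comp fun r => P r / 2, ← Finset.sum_div, hP.sum_eq]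
    norm_num

theorem ent_liftPmf (hπ : IsTwoCover π τ) {P : Q → ℝ} (hP : IsPmf P) :
    ent (liftPmf π P) = ent P + Real.log 2 := by
  have h : ∀ x : ℝ, Real.negMulLog (x / 2) = (Real.negMulLog x + x * Real.log 2) / 2 := by
    intro x
    rw [div_eq_mul_inv, Real.negMulLog_mul, Real.negMulLog.eq_1 2⁻¹, Real.log_inv]
    ring
  unfold ent liftPmf
  rw [hπ.sum_comp fun r => Real.negMulLog (P r / 2)]
  simp only [h]
  rw [← Finset.sum_div, Finset.sum_add_distrib, ← Finset.sum_mul, hP.sum_eq]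
  ring

theorem conv_liftPmf_liftPmf (hπ : IsTwoCover π τ) (P P' : Q → ℝ) :
    conv (liftPmf π P) (liftPmf π P') = liftPmf π (conv P P') := by
  funext g
  simp only [conv, liftPmf, map_sub]
  rw [hπ.sum_comp fun r => P r / 2 * (P' (π g - r) / 2), Finset.mul_sum, Finset.sum_div]
  exact Finset.sum_congr rfl fun r _ => by ring

end Extremal

/-- A family of probability mass functions, parametrized by their entropies in `[0, n log 2]`,
that starts at the point mass at `0` and is closed under convolution. -/
structure IsExtremalFamily {G : Type*} [AddCommGroup G] [Fintype G] (n : ℕ) (D : ℝ → G → ℝ) :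
    Prop where
  zero : D 0 = indicator {0} 1
  isPmf : ∀ t ∈ Icc 0 (n * Real.log 2), IsPmf (D t)
  ent_eq : ∀ t ∈ Icc 0 (n * Real.log 2), ent (D t) = t
  conv_eq : ∀ s ∈ Icc 0 (n * Real.log 2), ∀ t ∈ Icc 0 (n * Real.log 2),
    conv (D s) (D t) = D (levelSum n s t)

theorem exists_isExtremalFamily (n : ℕ) {G : Type u} [AddCommGroup G] [Fintype G]
    (hG : Fintype.card G = 2 ^ n) : ∃ D : ℝ → G → ℝ, IsExtremalFamily n D := by
  classical
  induction n generalizing G with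
  | zero =>
    have hsub := Fintype.card_le_one_iff_subsingleton.1 hG.le
    have : Unique G := uniqueOfSubsingleton 0
    refine ⟨fun _ _ => 1, ⟨?_, fun t _ => ⟨fun _ => zero_le_one, by simp⟩, ?_, ?_⟩⟩
    · funext g
      simp [Subsingleton.elim g 0]
    · intro t ht
      simp only [Nat.cast_zero, zero_mul, Icc_self, mem_singleton_iff] at ht
      simp [ent, ht]
    · intro s _ t _
      funext g
      simp [conv]
  | succ n ih =>
    obtain ⟨Q, _, _, π, τ, hπ, hQ⟩ := exists_isTwoCover hG
    obtain ⟨D, hD⟩ := ih hQ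
    have hτ := hπ.ne_zero
    set E : ℝ → G → ℝ := fun t => if t ≤ Real.log 2 then twoPoint τ (bias t)
      else liftPmf π (D (max (t - Real.log 2) 0)) with hE
    have hlow : ∀ {t}, t ≤ Real.log 2 → E t = twoPoint τ (bias t) := fun ht => if_pos ht
    have hhigh : ∀ {t}, Real.log 2 ≤ t → E t = liftPmf π (D (max (t - Real.log 2) 0)) := by
      intro t ht
      rcases eq_or_lt_of_le ht with h | h
      · subst h
        rw [hlow le_rfl, sub_self, max_self, hD.zero, bias_log_two, ← liftPmf_indicator hπ]
      · exact if_neg (not_le.2 h)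
    refine ⟨E, ⟨?_, ?_, ?_, ?_⟩⟩
    · rw [hlow log_two_pos.le, bias_zero]
      funext g
      simp [twoPoint, indicator_apply]
    · intro t ht
      rcases le_total t (Real.log 2) with h | h
      · rw [hlow h]; exact isPmf_twoPoint (bias_mem ⟨ht.1, h⟩)
      · rw [hhigh h]; exact isPmf_liftPmf hπ (hD.isPmf _ (max_sub_log_two_mem ht))
    · intro t ht
      rcases le_total t (Real.log 2) with h | h
      · rw [hlow h, ent_twoPoint hτ, biasEntropy_bias ⟨ht.1, h⟩]
      · have := max_sub_log_two_mem ht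
        rw [hhigh h, ent_liftPmf hπ (hD.isPmf _ this), hD.ent_eq _ this,
          max_eq_left (sub_nonneg.2 h)]
        ring
    · -- a variable of entropy at most `log 2` does not change one of entropy at least `log 2`
      have hmix : ∀ s ∈ Icc 0 ((n + 1 : ℕ) * Real.log 2), ∀ t ∈ Icc 0 ((n + 1 : ℕ) * Real.log 2),
          s ≤ Real.log 2 → Real.log 2 ≤ t → conv (E s) (E t) = E (levelSum (n + 1) s t) := by
        intro s hs t ht h h'
        have e : levelSum (n + 1) s t = t := by
          rw [levelSum_succ, min_eq_right h', bitSum_log_two_right,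
            max_eq_right (sub_nonpos.2 h), levelSum_zero_left n (max_sub_log_two_mem ht),
            max_eq_left (sub_nonneg.2 h')]
          ring
        rw [e, hlow h, hhigh h', conv_twoPoint_liftPmf hπ]
      intro s hs t ht
      rcases le_total s (Real.log 2) with h | h <;> rcases le_total t (Real.log 2) with h' | h'
      · have hs' : s ∈ Icc 0 (Real.log 2) := ⟨hs.1, h⟩
        have ht' : t ∈ Icc 0 (Real.log 2) := ⟨ht.1, h'⟩
        have e : levelSum (n + 1) s t = bitSum s t := by
          have h0 : (0 : ℝ) ∈ Icc 0 (n * Real.log 2) :=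
            ⟨le_rfl, by have := log_two_pos; positivity⟩
          rw [levelSum_succ, min_eq_left h, min_eq_left h', max_eq_right (sub_nonpos.2 h),
            max_eq_right (sub_nonpos.2 h'), levelSum_zero_left n h0, add_zero]
        have hm := mul_bias_mem hs' ht'
        rw [e, hlow h, hlow h', hlow (bitSum_mem hs' ht').2, conv_twoPoint_twoPoint hπ, bitSum,
          bias_biasEntropy (Icc_subset_Icc_left (by norm_num) hm), abs_of_nonneg hm.1]
      · exact hmix s hs t ht h h'
      · rw [conv_comm, levelSum_comm]
        exact hmix t ht s hs h' h
      · have hs' := max_sub_log_two_mem hs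
        have ht' := max_sub_log_two_mem ht
        have e : levelSum (n + 1) s t = Real.log 2 +
            levelSum n (max (s - Real.log 2) 0) (max (t - Real.log 2) 0) := by
          rw [levelSum_succ, min_eq_right h, bitSum_log_two_left]
        have hpos := (levelSum_mem n hs'.1 ht'.1).1
        rw [e, hhigh h, hhigh h', conv_liftPmf_liftPmf hπ, hD.conv_eq _ hs' _ ht',
          hhigh (by linarith), add_sub_cancel_left, max_eq_left hpos]

/-! ### Laws of sums of independent random variables -/

/-- The mass function of the law of `X`. -/
noncomputable def law {Ω : Type v} [MeasurableSpace Ω] {G : Type u} (P : Measure Ω) (X : Ω → G)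
    (g : G) : ℝ := P.real (X ⁻¹' {g})

section Law

variable {Ω : Type v} [MeasurableSpace Ω] {G : Type u} [Fintype G]
  [MeasurableSpace G] [DiscreteMeasurableSpace G] {P : Measure Ω} [IsProbabilityMeasure P]

theorem isPmf_law {X : Ω → G} (hX : Measurable X) : IsPmf (law P X) where
  nonneg _ := measureReal_nonneg
  sum_eq := by
    unfold law
    rw [sum_measureReal_preimage_singleton _ fun g _ => hX (measurableSet_singleton g)]
    simp

theorem law_add [AddCommGroup G] {X Y : Ω → G} (hX : Measurable X) (hY : Measurable Y)
    (h : IndepFun X Y P) : law P (X + Y) = conv (law P X) (law P Y) := by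
  funext g
  have hset : (X + Y) ⁻¹' {g} = ⋃ h ∈ (Finset.univ : Finset G), X ⁻¹' {h} ∩ Y ⁻¹' {g - h} := by
    ext ω
    simp [eq_sub_iff_add_eq, add_comm]
  rw [law, hset, measureReal_biUnion_finset]
  · refine Finset.sum_congr rfl fun k _ => ?_
    rw [measureReal_def, h.measure_inter_preimage_eq_mul _ _ (measurableSet_singleton k)
      (measurableSet_singleton _), ENNReal.toReal_mul]
    rfl
  · intro k _ l _ hkl
    refine Disjoint.mono inter_subset_left inter_subset_left ?_
    exact (disjoint_singleton.2 hkl).preimage X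
  · exact fun k _ => (hX (measurableSet_singleton k)).inter (hY (measurableSet_singleton _))

end Law

/-- Every family of mass functions is the family of laws of independent variables. -/
theorem exists_iIndepFun_law {G : Type u} [Fintype G] [MeasurableSpace G]
    [DiscreteMeasurableSpace G] {k : ℕ} {p : Fin k → G → ℝ} (hp : ∀ i, IsPmf (p i)) :
    ∃ (Ω : Type u) (_ : MeasurableSpace Ω) (P : Measure Ω) (X : Fin k → Ω → G),
      IsProbabilityMeasure P ∧ (∀ i, Measurable (X i)) ∧ iIndepFun X P ∧
        ∀ i, law P (X i) = p i := by
  have hsum : ∀ i, ∑ g, ENNReal.ofReal (p i g) = 1 := by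
    intro i
    rw [← ENNReal.ofReal_sum_of_nonneg fun g _ => (hp i).nonneg g, (hp i).sum_eq,
      ENNReal.ofReal_one]
  let μ : Fin k → Measure G := fun i => (PMF.ofFintype _ (hsum i)).toMeasure
  have hμ : ∀ i, IsProbabilityMeasure (μ i) := fun i => PMF.toMeasure.isProbabilityMeasure _
  refine ⟨Fin k → G, inferInstance, Measure.pi μ, fun i ω => ω i, inferInstance,
    fun i => measurable_pi_apply i, ?_, fun i => ?_⟩
  · exact iIndepFun_pi (X := fun _ g => g) fun i => aemeasurable_id
  · funext g
    have h1 : (Measure.pi μ).map (Function.eval i) = μ i := (measurePreserving_eval μ i).map_eq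
    have h2 : (Measure.pi μ) ((fun ω : Fin k → G => ω i) ⁻¹' {g}) = μ i {g} := by
      rw [← h1, Measure.map_apply (measurable_pi_apply i) (measurableSet_singleton g)]
    rw [law, measureReal_def, h2, PMF.toMeasure_apply_singleton _ _ (measurableSet_singleton g),
      PMF.ofFintype_apply, ENNReal.toReal_ofReal ((hp i).nonneg g)]

/-! ### Several summands -/

section Sums

variable {G : Type u} [AddCommGroup G] [Fintype G] [MeasurableSpace G] [DiscreteMeasurableSpace G]

theorem measurable_finsetSum {Ω : Type v} [MeasurableSpace Ω] {k : ℕ} {X : Fin k → Ω → G}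
    (hX : ∀ i, Measurable (X i)) (s : Finset (Fin k)) : Measurable (∑ i ∈ s, X i) := by
  have : MeasurableAdd₂ G := ⟨measurable_of_countable _⟩
  rw [Finset.sum_fn]
  exact Finset.measurable_sum s fun i _ => hX i

/-- The minimal entropy `c` of the sum over `s` is attained by the extremal family, whose members
add up to a member with entropy `c`; it depends on the entropies of the summands in `s` only. -/
theorem exists_minimal_entropy (n : ℕ) (hG : Fintype.card G = 2 ^ n) {D : ℝ → G → ℝ}
    (hD : IsExtremalFamily n D) {k : ℕ} (s : Finset (Fin k)) (x : Fin k → ℝ)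
    (hx : ∀ i ∈ s, x i ∈ Icc 0 (n * Real.log 2)) :
    ∃ c ∈ Icc 0 (n * Real.log 2), ∀ (Ω : Type u) (_ : MeasurableSpace Ω) (P : Measure Ω)
      (X : Fin k → Ω → G), IsProbabilityMeasure P → (∀ i, Measurable (X i)) → iIndepFun X P →
      ((∀ i ∈ s, law P (X i) = D (x i)) → law P (∑ i ∈ s, X i) = D c) ∧
      ((∀ i ∈ s, ent (law P (X i)) = x i) → c ≤ ent (law P (∑ i ∈ s, X i))) := by
  classical
  induction s using Finset.induction_on with
  | empty =>
    refine ⟨0, ⟨le_rfl, by have := log_two_pos; positivity⟩, fun Ω _ P X _ hX _ =>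
      ⟨fun _ => ?_, fun _ => (ent_mem n hG (isPmf_law (measurable_finsetSum hX ∅))).1⟩⟩
    rw [hD.zero, Finset.sum_empty]
    funext g
    by_cases hg : g = 0
    · subst hg
      have : (0 : Ω → G) ⁻¹' {0} = univ := by ext; simp
      rw [law, this]
      simp
    · have : (0 : Ω → G) ⁻¹' {g} = ∅ := by ext; simp [Ne.symm hg]
      rw [law, this]
      simp [hg]
  | insert j s hj ih =>
    obtain ⟨c, hc, ih⟩ := ih fun i hi => hx i (Finset.mem_insert_of_mem hi)
    have hxj := hx j (Finset.mem_insert_self j s)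
    refine ⟨levelSum n (x j) c, levelSum_mem n hxj.1 hc.1, fun Ω _ P X _ hX hind => ?_⟩
    obtain ⟨ih1, ih2⟩ := ih Ω _ P X inferInstance hX hind
    have : MeasurableAdd₂ G := ⟨measurable_of_countable _⟩
    have hsm := measurable_finsetSum hX s
    have hlaw : law P (∑ i ∈ insert j s, X i) = conv (law P (X j)) (law P (∑ i ∈ s, X i)) := by
      rw [Finset.sum_insert hj, law_add (hX j) hsm (hind.indepFun_finsetSum_of_notMem hX hj).symm]
    rw [hlaw]
    constructor
    · intro h
      rw [h j (Finset.mem_insert_self j s), ih1 fun i hi => h i (Finset.mem_insert_of_mem hi),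
        hD.conv_eq _ hxj _ hc]
    · intro h
      have h1 := ih2 fun i hi => h i (Finset.mem_insert_of_mem hi)
      calc levelSum n (x j) c ≤ levelSum n (x j) (ent (law P (∑ i ∈ s, X i))) :=
            levelSum_mono_right n hxj.1 hc.1 h1
        _ = levelSum n (ent (law P (X j))) (ent (law P (∑ i ∈ s, X i))) := by
            rw [h j (Finset.mem_insert_self j s)]
        _ ≤ _ := levelSum_le_ent_conv n hG (isPmf_law (hX j)) (isPmf_law hsm)

/-- If the entropies of all variables but the `i`-th are fixed, then the minimal entropy of the
sum is a section of `levelSum`. -/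
theorem exists_isLeast_sumEntropies (n : ℕ) (hG : Fintype.card G = 2 ^ n) {k : ℕ} (i : Fin k)
    (x : Fin k → ℝ) (hx : ∀ j, j ≠ i → x j ∈ Icc 0 (n * Real.log 2)) :
    ∃ c ∈ Icc 0 (n * Real.log 2), ∀ t ∈ Icc 0 (n * Real.log 2),
      IsLeast (sumEntropies G k (Function.update x i t)) (levelSum n t c) := by
  classical
  obtain ⟨D, hD⟩ := exists_isExtremalFamily n hG
  obtain ⟨c, hc, hmin⟩ := exists_minimal_entropy n hG hD (Finset.univ.erase i) x
    fun j hj => hx j (Finset.ne_of_mem_erase hj)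
  refine ⟨c, hc, fun t ht => ?_⟩
  set y := Function.update x i t with hy
  have hyi : y i = t := Function.update_self i t x
  have hyj : ∀ j ∈ Finset.univ.erase i, y j = x j := fun j hj =>
    Function.update_of_ne (Finset.ne_of_mem_erase hj) t x
  have hym : ∀ j, y j ∈ Icc 0 (n * Real.log 2) := by
    intro j
    by_cases hj : j = i
    · rw [hj, hyi]; exact ht
    · rw [hyj j (Finset.mem_erase.2 ⟨hj, Finset.mem_univ j⟩)]
      exact hx j hj
  have hlaw : ∀ (Ω : Type u) (_ : MeasurableSpace Ω) (P : Measure Ω) (X : Fin k → Ω → G),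
      IsProbabilityMeasure P → (∀ i, Measurable (X i)) → iIndepFun X P →
      shannonEntropy P (fun ω => ∑ i, X i ω) =
        ent (conv (law P (X i)) (law P (∑ j ∈ Finset.univ.erase i, X j))) := by
    intro Ω _ P X _ hX hind
    have : MeasurableAdd₂ G := ⟨measurable_of_countable _⟩
    rw [← law_add (hX i) (measurable_finsetSum hX _) (hind.indepFun_finsetSum_of_notMem hX
      (Finset.notMem_erase i _)).symm, Finset.add_sum_erase _ _ (Finset.mem_univ i)]
    change ent (law P _) = _
    congr 2
    funext ω
    rw [Finset.sum_apply]
  constructor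
  · obtain ⟨Ω, _, P, X, hP, hX, hind, hlawX⟩ := exists_iIndepFun_law fun j => hD.isPmf (y j) (hym j)
    refine ⟨Ω, _, P, X, hP, hX, hind, fun j => ?_, ?_⟩
    · change ent (law P (X j)) = _
      rw [hlawX, hD.ent_eq _ (hym j)]
    · rw [hlaw Ω _ P X hP hX hind, hlawX, hyi, (hmin Ω _ P X hP hX hind).1
        fun j hj => by rw [hlawX, hyj j hj], hD.conv_eq _ ht _ hc,
        hD.ent_eq _ (levelSum_mem n ht.1 hc.1)]
  · rintro h ⟨Ω, _, P, X, hP, hX, hind, hent, rfl⟩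
    have hent' : ∀ j, ent (law P (X j)) = y j := hent
    rw [hlaw Ω _ P X hP hX hind]
    have h1 := (hmin Ω _ P X hP hX hind).2 fun j hj => by rw [hent', hyj j hj]
    calc levelSum n t c ≤ levelSum n t (ent (law P (∑ j ∈ Finset.univ.erase i, X j))) :=
          levelSum_mono_right n ht.1 hc.1 h1
      _ = levelSum n (ent (law P (X i))) (ent (law P (∑ j ∈ Finset.univ.erase i, X j))) := by
          rw [hent', hyi]
      _ ≤ _ := levelSum_le_ent_conv n hG (isPmf_law (hX i)) (isPmf_law (measurable_finsetSum hX _))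

end Sums

end EntropySum

theorem corollary6p6 {G : Type u} [AddCommGroup G] [Fintype G] [MeasurableSpace G]
    [DiscreteMeasurableSpace G] (n : ℕ) (hG : Fintype.card G = 2 ^ n) (k : ℕ) (hk : 2 ≤ k) :
    (∀ x : Fin k → ℝ, (∀ j, x j ∈ Set.Icc 0 (Real.log (Fintype.card G))) →
      IsLeast (sumEntropies G k x) (minSumEntropy G k x)) ∧
    (∀ (i : Fin k) (x : Fin k → ℝ),
      (∀ j, j ≠ i → x j ∈ Set.Icc 0 (Real.log (Fintype.card G))) →
      ConvexOn ℝ (Set.Icc 0 (Real.log (Fintype.card G)))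
        (fun t : ℝ => minSumEntropy G k (Function.update x i t))) := by
  have hlog : Real.log (Fintype.card G) = n * Real.log 2 := by
    rw [hG, Nat.cast_pow, Real.log_pow, Nat.cast_ofNat]
  rw [hlog]
  constructor
  · intro x hx
    obtain ⟨c, -, hc⟩ := EntropySum.exists_isLeast_sumEntropies n hG (⟨0, by omega⟩ : Fin k) x
      fun j _ => hx j
    have h := hc _ (hx ⟨0, by omega⟩)
    rw [Function.update_eq_self] at h
    rw [minSumEntropy, h.csInf_eq]
    exact h
  · intro i x hx
    obtain ⟨c, hc, hmin⟩ := EntropySum.exists_isLeast_sumEntropies n hG i x hx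
    exact (EntropySum.convexOn_levelSum n hc).congr fun t ht => (hmin t ht).csInf_eq.symm
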